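/- Let $d\in\mathbb N$ and $\varphi\colon(0,1]\to[0,d]$. For a non-empty metric space $X$, $x\in X$, $r>0$ and $E\subset X$, let $B(x,r)$ be the closed ball in $X$ and let $N_r(E)$ be the least number of closed balls of radius $r$ needed to cover $E$. For $0<\theta<1$ the monotone lower spectrum of $X$ is $$\underline{\dim}^{\theta}_{\mathrm L}X=\sup\Bigl\{s\ge 0:\exists C>0\ \forall\, 0<r\le r^\theta\le R<1,\ \inf_{x\in X}N_r(B(x,R))\ge C\Bigl(\frac Rr\Bigr)^s\Bigr\},$$ and $(1-\theta)\,\underline{\dim}^{\theta}_{\mathrm L}X$ is understood to be $0$ at $\theta=1$. For $\lambda\in(0,1]$ and $0\le t\le d(1-\lambda)$ let $$\phi_{d,\lambda,t}(\theta)=\begin{cases} d+\frac{\theta}{\lambda}(t-d), & 0<\theta\le\lambda,\\ t\,\frac{1-\theta}{1-\lambda}, & \lambda<\theta\le 1.\end{cases}$$ Then the following are equivalent. 1. There is a non-empty set $F\subset\mathbb R^d$ (with the Euclidean metric) such that $(1-\theta)\,\underline{\dim}^{\theta}_{\mathrm L}F=\varphi(\theta)$ for all $\theta\in(0,1]$.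 2. The function $\theta\mapsto\varphi(\theta)/(1-\theta)$ is decreasing (not necessarily strictly) on $(0,1)$, $\varphi(1)=0$, and $\varphi(\lambda\theta)-\theta\varphi(\lambda)\le(1-\theta)d$ for all $\lambda,\theta\in(0,1]$. 3. $\varphi$ is the pointwise infimum on $(0,1]$ of a non-empty family of functions of the form $\phi_{d,\lambda,t}$ with $\lambda\in(0,1]$ and $0\le t\le d(1-\lambda)$. -/

import Mathlib

open scoped NNReal ENNReal

/-- `N_r(E)`: the least number of closed balls of radius `r`, centred in the metric space `X`,
needed to cover `E ⊆ X` (it is `⊤` if no finite number suffices). -/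
noncomputable def closedBallCoveringNumber {X : Type*} [MetricSpace X] (r : ℝ) (E : Set X) : ℕ∞ :=
  Metric.externalCoveringNumber r.toNNReal E

/-- The exponent `s` is admissible for the monotone lower spectrum of `X` at `θ`: there is `C > 0`
such that `inf_{x ∈ X} N_r(B(x, R)) ≥ C (R / r) ^ s` whenever `0 < r ≤ r ^ θ ≤ R < 1`. -/
def IsMonotoneLowerExponent (X : Type*) [MetricSpace X] (θ : ℝ) (s : ℝ) : Prop :=
  ∃ C : ℝ, 0 < C ∧ ∀ r R : ℝ, 0 < r → r ≤ r ^ θ → r ^ θ ≤ R → R < 1 →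
    ENNReal.ofReal (C * (R / r) ^ s) ≤
      ⨅ x : X, (closedBallCoveringNumber r (Metric.closedBall x R) : ℝ≥0∞)

/-- The monotone lower spectrum (also called quasi-lower spectrum) of the metric space `X` at
`0 < θ < 1`: the supremum, in `[0, ∞]`, of the admissible exponents `s ≥ 0`. -/
noncomputable def monotoneLowerSpectrum (X : Type*) [MetricSpace X] (θ : ℝ) : ℝ≥0∞ :=
  ⨆ (s : ℝ≥0) (_ : IsMonotoneLowerExponent X θ s), (s : ℝ≥0∞)

/-- `(1 - θ)` times the monotone lower spectrum of `X` at `θ`, for `0 < θ ≤ 1`. The spectrum itself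
is only defined for `θ < 1`; at `θ = 1` the product means `0` by convention. -/
noncomputable def scaledMonotoneLowerSpectrum (X : Type*) [MetricSpace X] (θ : ℝ) : ℝ≥0∞ :=
  if θ = 1 then 0 else ENNReal.ofReal (1 - θ) * monotoneLowerSpectrum X θ

/-- The continuous function of `θ ∈ (0, 1]` with two affine pieces that joins the points `(0, α)`,
`(l, t)` and `(1, 0)`, for `0 < l ≤ 1` and `0 ≤ t ≤ α (1 - l)`. -/
noncomputable def twoPieceAffine (α l t θ : ℝ) : ℝ :=
  if θ ≤ l then α + θ / l * (t - α) else t * ((1 - θ) / (1 - l))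

/-! Both inequalities in condition 2 describe the graph of `φ` as seen from an endpoint. From `(1,
0)`: `φ θ / (1 - θ)` decreases, because for `r < 1` the range `r ^ θ ≤ R` of permitted scales grows
with `θ`. From `(0, d)`: the slope `(φ θ - d) / θ` increases, because a cover at scale `r` can be
refined to scale `r' ≤ r` at the cost of a factor `(4 r / r') ^ d`, which transfers an admissible
exponent at `l * θ` to one at `l` (`IsMonotoneLowerExponent.of_mul`).

Hence `φ` lies below the path `(0, d)`, `(l, φ l)`, `(1, 0)` for every `l` and touches it at `l`;
this is condition 3. Conversely each such path is convex, so it has both slope properties, and these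
survive infima (`conditions_iff_isGLB_twoPieceAffine`).

To realise a given `φ`, put `β θ = φ θ / (d (1 - θ))` and build a subset of the line from binary
expansions. Every pair `a < b` contributes a small piece whose digits are free with density `β (a /
b)` at places in `(a, b]` and completely free afterwards. A copy of the dyadic rationals nearby
ensures that balls much larger than the piece see dimension one. Counting free digits between the
places of `R` and `r` bounds covering numbers from below, and the paths through `(a / b, φ (a / b))`
are exactly what makes `d * β θ` admissible for the `d`-fold product
(`isMonotoneLowerExponent_thinnedLine`). From above, the pieces `(k a, k b)`, `k → ∞`, show that an
admissible exponent at `θ` is at most `d * β q` for each rational `q < θ`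
(`IsMonotoneLowerExponent.le_thinnedLine`). The slope condition from `(0, d)` controls the limit `q
→ θ`, so no continuity of `φ` is needed. -/

/-! ### Covering numbers and admissible exponents -/

theorem closedBallCoveringNumber_le_card {X : Type*} [MetricSpace X] {r : ℝ} (hr : 0 ≤ r)
    {E : Set X} (D : Finset X) (hD : ∀ x ∈ E, ∃ y ∈ D, dist x y ≤ r) :
    closedBallCoveringNumber r E ≤ D.card := by
  have h : Metric.IsCover r.toNNReal E (D : Set X) := by
    rw [Metric.isCover_iff_subset_iUnion_closedBall]
    intro x hx
    obtain ⟨y, hy, hxy⟩ := hD x hx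
    simp only [Set.mem_iUnion, Metric.mem_closedBall, Real.coe_toNNReal r hr]
    exact ⟨y, hy, hxy⟩
  simpa [closedBallCoveringNumber] using h.externalCoveringNumber_le_encard

theorem exists_finset_of_closedBallCoveringNumber_le {X : Type*} [MetricSpace X] {r : ℝ}
    (hr : 0 ≤ r) {E : Set X} {n : ℕ} (h : closedBallCoveringNumber r E ≤ n) :
    ∃ D : Finset X, D.card ≤ n ∧ ∀ x ∈ E, ∃ y ∈ D, dist x y ≤ r := by
  have h1 : closedBallCoveringNumber r E < (n + 1 : ℕ) :=
    h.trans_lt (by exact_mod_cast Nat.lt_succ_self n)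
  simp only [closedBallCoveringNumber, Metric.externalCoveringNumber, iInf_lt_iff] at h1
  obtain ⟨C, hC, hlt⟩ := h1
  have hfin : C.Finite := Set.finite_of_encard_le_coe hlt.le
  refine ⟨hfin.toFinset, ?_, fun x hx => ?_⟩
  · rw [hfin.encard_eq_coe_toFinset_card] at hlt
    exact Nat.lt_succ_iff.1 (by exact_mod_cast hlt)
  · rw [Metric.isCover_iff_subset_iUnion_closedBall] at hC
    have := hC hx
    simp only [Set.mem_iUnion, Metric.mem_closedBall, Real.coe_toNNReal r hr] at this
    obtain ⟨y, hy, hxy⟩ := this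
    exact ⟨y, by simpa using hy, hxy⟩

theorem ofReal_le_closedBallCoveringNumber_iff {X : Type*} [MetricSpace X] {r : ℝ} (hr : 0 ≤ r)
    {E : Set X} {v : ℝ} :
    ENNReal.ofReal v ≤ (closedBallCoveringNumber r E : ℝ≥0∞) ↔
      ∀ D : Finset X, (∀ x ∈ E, ∃ y ∈ D, dist x y ≤ r) → v ≤ D.card := by
  constructor
  · intro h D hD
    have h1 : ENNReal.ofReal v ≤ ((D.card : ℕ∞) : ℝ≥0∞) :=
      h.trans (ENat.toENNReal_le.2 (closedBallCoveringNumber_le_card hr D hD))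
    rw [ENat.toENNReal_coe] at h1
    simpa using ENNReal.ofReal_le_iff_le_toReal (ENNReal.natCast_ne_top _) |>.1 h1
  · intro h
    by_cases ht : closedBallCoveringNumber r E = ⊤
    · simp [ht]
    · obtain ⟨n, hn⟩ := ENat.ne_top_iff_exists.1 ht
      obtain ⟨D, hDn, hD⟩ := exists_finset_of_closedBallCoveringNumber_le hr hn.symm.le
      have h1 : v ≤ n := (h D hD).trans (by exact_mod_cast hDn)
      rw [← hn, ENat.toENNReal_coe]
      exact (ENNReal.ofReal_le_ofReal h1).trans (by simp)

theorem isMonotoneLowerExponent_iff {X : Type*} [MetricSpace X] {θ s : ℝ} :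
    IsMonotoneLowerExponent X θ s ↔
      ∃ C : ℝ, 0 < C ∧ ∀ r R : ℝ, 0 < r → r ≤ r ^ θ → r ^ θ ≤ R → R < 1 →
        ∀ (x : X) (D : Finset X), (∀ z ∈ Metric.closedBall x R, ∃ y ∈ D, dist z y ≤ r) →
          C * (R / r) ^ s ≤ D.card := by
  refine exists_congr fun C => and_congr_right fun _ => ?_
  refine forall₄_congr fun r R hr _ => forall₂_congr fun _ _ => ?_
  rw [le_iInf_iff]
  exact forall_congr' fun x => ofReal_le_closedBallCoveringNumber_iff hr.le

theorem isMonotoneLowerExponent_mono {X : Type*} [MetricSpace X] {θ θ' s : ℝ} (h : θ ≤ θ')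
    (h1 : θ' ≤ 1) (h0 : 0 < θ)
    (hs : IsMonotoneLowerExponent X θ' s) : IsMonotoneLowerExponent X θ s := by
  obtain ⟨C, hC, H⟩ := hs
  refine ⟨C, hC, fun r R hr hrθ hR hR1 => ?_⟩
  have hr1 : r ≤ 1 := by
    by_contra! hr1
    exact absurd (Real.one_le_rpow hr1.le h0.le) (by linarith)
  refine H r R hr ?_ ((Real.rpow_le_rpow_of_exponent_ge hr hr1 h).trans hR) hR1
  simpa using Real.rpow_le_rpow_of_exponent_ge hr hr1 h1

/-! ### Packing and refinement of covers in `ℝ^d` -/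

/-- Volume comparison: balls of radius `r / 2` about the points are disjoint and lie in a ball of
radius `ρ + r ≤ 2 ρ`. -/
theorem card_le_of_separated_closedBall {d : ℕ} (s : Finset (EuclideanSpace ℝ (Fin d)))
    {x : EuclideanSpace ℝ (Fin d)} {r ρ : ℝ} (hr : 0 < r) (hρ : r ≤ ρ)
    (hs : ∀ c ∈ s, dist c x ≤ ρ) (h : ∀ c ∈ s, ∀ e ∈ s, c ≠ e → r < dist c e) :
    (s.card : ℝ) ≤ (4 * ρ / r) ^ d := by
  classical
  let μ : MeasureTheory.Measure (EuclideanSpace ℝ (Fin d)) := MeasureTheory.Measure.addHaar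
  have D : Set.Pairwise (s : Set (EuclideanSpace ℝ (Fin d)))
      (Function.onFun Disjoint fun c => Metric.ball c (r / 2)) := by
    intro c hc e he hce
    apply Metric.ball_disjoint_ball
    linarith [h c hc e he hce]
  have A : (⋃ c ∈ s, Metric.ball c (r / 2)) ⊆ Metric.ball x (ρ + r) := by
    refine Set.iUnion₂_subset fun c hc => Metric.ball_subset_ball' ?_
    linarith [hs c hc]
  have I : (s.card : ℝ≥0∞) * ENNReal.ofReal ((r / 2) ^ d) * μ (Metric.ball 0 1) ≤
      ENNReal.ofReal ((ρ + r) ^ d) * μ (Metric.ball 0 1) := by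
    calc (s.card : ℝ≥0∞) * ENNReal.ofReal ((r / 2) ^ d) * μ (Metric.ball 0 1)
        = μ (⋃ c ∈ s, Metric.ball c (r / 2)) := by
          rw [MeasureTheory.measure_biUnion_finset D fun c _ => measurableSet_ball]
          simp only [μ, MeasureTheory.Measure.addHaar_ball_of_pos _ _ (half_pos hr),
            finrank_euclideanSpace_fin, Finset.sum_const, nsmul_eq_mul, mul_assoc]
      _ ≤ μ (Metric.ball x (ρ + r)) := MeasureTheory.measure_mono A
      _ = _ := by
          simp only [μ, MeasureTheory.Measure.addHaar_ball_of_pos _ _ (by linarith : 0 < ρ + r),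
            finrank_euclideanSpace_fin]
  have J : (s.card : ℝ≥0∞) * ENNReal.ofReal ((r / 2) ^ d) ≤ ENNReal.ofReal ((ρ + r) ^ d) :=
    (ENNReal.mul_le_mul_iff_left (Metric.measure_ball_pos _ _ zero_lt_one).ne'
      MeasureTheory.measure_ball_lt_top.ne).1 I
  have K : (s.card : ℝ) * (r / 2) ^ d ≤ (ρ + r) ^ d := by
    rw [← ENNReal.ofReal_natCast, ← ENNReal.ofReal_mul (by positivity)] at J
    exact (ENNReal.ofReal_le_ofReal_iff (pow_nonneg (by linarith) _)).1 J
  rw [← le_div_iff₀ (by positivity), ← div_pow] at K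
  refine K.trans (pow_le_pow_left₀ (div_nonneg (by linarith) (by linarith)) ?_ d)
  rw [div_le_div_iff₀ (by positivity) hr]
  nlinarith

/-- The centres must lie in `F`, since covering numbers are taken in the metric space `F`. Packing
numbers dominate covering numbers with centres in the set, and only they see the volume of the
ambient space. -/
theorem exists_finset_cover_closedBall {d : ℕ} (F : Set (EuclideanSpace ℝ (Fin d))) (y : F)
    {r ρ : ℝ} (hr : 0 < r) (hρ : r ≤ ρ) :
    ∃ D : Finset F, (D.card : ℝ) ≤ (4 * ρ / r) ^ d ∧
      ∀ z ∈ Metric.closedBall y ρ, ∃ w ∈ D, dist z w ≤ r := by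
  have hρ0 : 0 ≤ ρ := hr.le.trans hρ
  have h1 : Metric.packingNumber r.toNNReal (Metric.closedBall y ρ) ≤
      (⌊(4 * ρ / r) ^ d⌋₊ : ℕ) := by
    refine iSup_le fun C => iSup_le fun hC => iSup_le fun hsep => ?_
    have hcard : ∀ T : Finset F, (T : Set F) ⊆ C → T.card ≤ ⌊(4 * ρ / r) ^ d⌋₊ := by
      intro T hT
      refine Nat.le_floor ?_
      rw [← Finset.card_map (Function.Embedding.subtype (· ∈ F))]
      refine card_le_of_separated_closedBall _ (x := y) hr hρ ?_ ?_
      · intro c hc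
        obtain ⟨c, hcT, rfl⟩ := Finset.mem_map.1 hc
        exact Metric.mem_closedBall.1 (hC (hT hcT))
      · intro c hc e he hce
        obtain ⟨c, hcT, rfl⟩ := Finset.mem_map.1 hc
        obtain ⟨e, heT, rfl⟩ := Finset.mem_map.1 he
        have h2 := hsep (hT hcT) (hT heT) (fun h => hce (congrArg _ h))
        beta_reduce at h2
        rw [edist_dist] at h2
        have h3 : ENNReal.ofReal r < ENNReal.ofReal (dist c e) := h2
        exact (ENNReal.ofReal_lt_ofReal_iff_of_nonneg hr.le).1 h3
    rcases C.finite_or_infinite with hf | hi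
    · rw [hf.encard_eq_coe_toFinset_card]
      exact_mod_cast hcard hf.toFinset (by simp)
    · obtain ⟨T, hT, hTc⟩ := hi.exists_subset_card_eq (⌊(4 * ρ / r) ^ d⌋₊ + 1)
      exact absurd (hcard T hT) (by omega)
  have h2 : closedBallCoveringNumber r (Metric.closedBall y ρ) ≤ (⌊(4 * ρ / r) ^ d⌋₊ : ℕ) :=
    ((Metric.externalCoveringNumber_le_coveringNumber _ _).trans
      (Metric.coveringNumber_le_packingNumber _ _)).trans h1
  obtain ⟨D, hD, hD'⟩ := exists_finset_of_closedBallCoveringNumber_le hr.le h2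
  exact ⟨D, (Nat.cast_le.2 hD).trans (Nat.floor_le (by positivity)), hD'⟩

theorem exists_finset_cover_refine {d : ℕ} {F : Set (EuclideanSpace ℝ (Fin d))}
    {r ρ : ℝ} (hr : 0 < r) (hρ : r ≤ ρ) {E : Set F} {D : Finset F}
    (hD : ∀ z ∈ E, ∃ w ∈ D, dist z w ≤ ρ) :
    ∃ D' : Finset F, (D'.card : ℝ) ≤ D.card * (4 * ρ / r) ^ d ∧
      ∀ z ∈ E, ∃ w ∈ D', dist z w ≤ r := by
  classical
  choose G hG hG' using fun y : F => exists_finset_cover_closedBall F y hr hρ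
  refine ⟨D.biUnion G, ?_, fun z hz => ?_⟩
  · calc ((D.biUnion G).card : ℝ) ≤ ((∑ y ∈ D, (G y).card : ℕ) : ℝ) := by
          exact_mod_cast Finset.card_biUnion_le
      _ ≤ ∑ y ∈ D, (4 * ρ / r) ^ d := by
          push_cast
          exact Finset.sum_le_sum fun y _ => hG y
      _ = _ := by simp
  · obtain ⟨y, hy, hzy⟩ := hD z hz
    obtain ⟨w, hw, hzw⟩ := hG' y z hzy
    exact ⟨w, Finset.mem_biUnion.2 ⟨y, hy, hw⟩, hzw⟩

/-! ### Necessity of the two slope conditions -/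

/-- Comparison of exponential growth rates along the natural numbers. -/
theorem exponent_le_of_growth {c K B s t : ℝ} (hc : 0 < c) (hB : 1 < B) (n₀ : ℕ)
    (h : ∀ n : ℕ, n₀ ≤ n → c * (B ^ n) ^ s ≤ K * (B ^ n) ^ t) : s ≤ t := by
  by_contra! hst
  have hB0 : 0 < B := by linarith
  have h1 : 1 < B ^ (s - t) := Real.one_lt_rpow hB (by linarith)
  obtain ⟨N, hN⟩ := ((tendsto_pow_atTop_atTop_of_one_lt h1).eventually_gt_atTop (K / c)).exists_forall_of_atTop
  have h2 := hN (max N n₀) (le_max_left _ _)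
  have h3 := h (max N n₀) (le_max_right _ _)
  set n := max N n₀
  have hp : 0 < B ^ n := by positivity
  have h4 : (B ^ (s - t)) ^ n = (B ^ n) ^ s / (B ^ n) ^ t := by
    rw [← Real.rpow_sub hp, ← Real.rpow_natCast, ← Real.rpow_natCast, ← Real.rpow_mul hB0.le,
      ← Real.rpow_mul hB0.le, mul_comm]
  rw [h4, div_lt_div_iff₀ hc (by positivity)] at h2
  linarith

theorem IsMonotoneLowerExponent.le_dimension {d : ℕ} {F : Set (EuclideanSpace ℝ (Fin d))}
    (hF : F.Nonempty) {θ s : ℝ} (h0 : 0 < θ) (h1 : θ < 1)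
    (hs : IsMonotoneLowerExponent F θ s) : s ≤ d := by
  obtain ⟨C, hC, H⟩ := isMonotoneLowerExponent_iff.1 hs
  obtain ⟨x⟩ := hF.to_subtype
  obtain ⟨n₀, hn₀⟩ := exists_nat_ge (1 / θ)
  refine exponent_le_of_growth (K := 4 ^ d) hC one_lt_two n₀ fun n hn => ?_
  have hr : (0 : ℝ) < (1 / 2) ^ (n + 1) := by positivity
  have hr1 : ((1 : ℝ) / 2) ^ (n + 1) ≤ 1 := pow_le_one₀ (by norm_num) (by norm_num)
  have hle : ((1 : ℝ) / 2) ^ (n + 1) ≤ 1 / 2 := by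
    simpa using pow_le_pow_of_le_one (by norm_num : (0 : ℝ) ≤ 1 / 2) (by norm_num)
      (by omega : 1 ≤ n + 1)
  obtain ⟨D, hD, hD'⟩ := exists_finset_cover_closedBall F x hr hle
  have hq : (1 / 2 : ℝ) / (1 / 2) ^ (n + 1) = 2 ^ n := by
    rw [pow_succ, one_div_pow]; field_simp
  have := H ((1 / 2) ^ (n + 1)) (1 / 2) hr ?_ ?_ (by norm_num) x D hD'
  · rw [mul_div_assoc, hq, mul_pow] at hD
    rw [hq] at this
    rw [Real.rpow_natCast]
    exact this.trans hD
  · simpa using Real.rpow_le_rpow_of_exponent_ge hr hr1 h1.le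
  · rw [← Real.rpow_natCast, ← Real.rpow_mul (by norm_num)]
    have hn' : (n₀ : ℝ) ≤ n := by exact_mod_cast hn
    have : 1 ≤ ((n + 1 : ℕ) : ℝ) * θ := by
      rw [div_le_iff₀ h0] at hn₀
      push_cast
      nlinarith
    simpa using Real.rpow_le_rpow_of_exponent_ge (by norm_num : (0 : ℝ) < 1 / 2) (by norm_num) this

/-- With `r' = r ^ (1 / θ)` the threshold `r' ^ (l * θ)` equals `r ^ l`, so every `R` permitted for
`r` at `l` is permitted for `r'` at `l * θ`. The lower bound at scale `r'` then descends to scale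
`r` by refinement of covers. -/
theorem IsMonotoneLowerExponent.of_mul {d : ℕ} {F : Set (EuclideanSpace ℝ (Fin d))}
    (hF : F.Nonempty) {l θ s s' : ℝ} (hl : 0 < l) (hl1 : l < 1) (h0 : 0 < θ) (h1 : θ ≤ 1)
    (hs : IsMonotoneLowerExponent F (l * θ) s)
    (hs' : θ * (1 - l) * s' = s * (1 - l * θ) - (1 - θ) * d) :
    IsMonotoneLowerExponent F l s' := by
  have hsd : s ≤ d := hs.le_dimension hF (by positivity) (by nlinarith)
  have hss : s' ≤ s := by
    by_contra! h
    have h2 : 0 < θ * (1 - l) := by have : 0 < 1 - l := by linarith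
                                    positivity
    nlinarith
  rw [isMonotoneLowerExponent_iff] at hs ⊢
  obtain ⟨C, hC, H⟩ := hs
  refine ⟨C / 4 ^ d, by positivity, fun r R hr hrl hR hR1 x D hD => ?_⟩
  have hr1 : r < 1 := by linarith
  have hR0 : 0 < R := (Real.rpow_pos_of_pos hr l).trans_le hR
  set r' := r ^ (1 / θ) with hr'
  have hr'0 : 0 < r' := Real.rpow_pos_of_pos hr _
  have hr'r : r' ≤ r := by
    simpa [hr'] using Real.rpow_le_rpow_of_exponent_ge hr hr1.le (one_le_one_div h0 h1)
  have hr'l : r' ^ (l * θ) = r ^ l := by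
    rw [hr', ← Real.rpow_mul hr.le]; congr 1; field_simp
  obtain ⟨D', hDc, hD'⟩ := exists_finset_cover_refine hr'0 hr'r hD
  have h3 := H r' R hr'0 (by rw [hr'l]; linarith) (by rw [hr'l]; exact hR) hR1 x D' hD'
  have hlog : Real.log r' = Real.log r / θ := by rw [hr', Real.log_rpow hr]; ring
  have hlR : l * Real.log r ≤ Real.log R := by
    rw [← Real.log_rpow hr]; exact Real.log_le_log (by positivity) hR
  -- The relation defining `s'` makes this an equality at `R = r ^ l` (this is `e1`); it persists
  -- for larger `R` because `s' ≤ s`.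
  have key : (R / r) ^ s' * (r / r') ^ d ≤ (R / r') ^ s := by
    rw [← Real.rpow_natCast, ← Real.log_le_log_iff (by positivity) (by positivity),
      Real.log_mul (by positivity) (by positivity), Real.log_rpow (by positivity),
      Real.log_rpow (by positivity), Real.log_rpow (by positivity),
      Real.log_div hR0.ne' hr.ne', Real.log_div hr.ne' hr'0.ne', Real.log_div hR0.ne' hr'0.ne',
      hlog]
    have e1 : s' * (l * Real.log r - Real.log r) + d * (Real.log r - Real.log r / θ) =
        s * (l * Real.log r - Real.log r / θ) := by
      field_simp
      linear_combination (-Real.log r) * hs'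
    nlinarith
  rw [mul_div_assoc, mul_pow] at hDc
  have h4 : C * ((R / r) ^ s' * (r / r') ^ d) ≤ D.card * (4 ^ d * (r / r') ^ d) :=
    (mul_le_mul_of_nonneg_left key hC.le).trans (h3.trans hDc)
  have h5 : 0 < (r / r') ^ d := by positivity
  have h6 : C * (R / r) ^ s' ≤ D.card * 4 ^ d := by
    refine le_of_mul_le_mul_right ?_ h5
    linarith
  rw [div_mul_eq_mul_div, div_le_iff₀ (by positivity)]
  exact h6

theorem IsMonotoneLowerExponent.mul_le_of_scaled_eq {X : Type*} [MetricSpace X] {θ s v : ℝ}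
    (h1 : θ < 1) (hv : 0 ≤ v) (hX : scaledMonotoneLowerSpectrum X θ = ENNReal.ofReal v)
    (hs : IsMonotoneLowerExponent X θ s) : (1 - θ) * s ≤ v := by
  rcases lt_or_ge s 0 with h | h
  · nlinarith
  have h2 : (s.toNNReal : ℝ≥0∞) ≤ monotoneLowerSpectrum X θ :=
    le_iSup₂_of_le s.toNNReal (by rwa [Real.coe_toNNReal s h]) le_rfl
  rw [scaledMonotoneLowerSpectrum, if_neg h1.ne] at hX
  have h3 : ENNReal.ofReal ((1 - θ) * s) ≤ ENNReal.ofReal v := by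
    rw [← hX, ENNReal.ofReal_mul (by linarith)]
    gcongr
    exact h2
  exact (ENNReal.ofReal_le_ofReal_iff hv).1 h3

theorem scaledMonotoneLowerSpectrum_le {X : Type*} [MetricSpace X] {θ v : ℝ}
    (h1 : θ < 1) (H : ∀ s, 0 ≤ s → IsMonotoneLowerExponent X θ s → (1 - θ) * s ≤ v) :
    scaledMonotoneLowerSpectrum X θ ≤ ENNReal.ofReal v := by
  rw [scaledMonotoneLowerSpectrum, if_neg h1.ne, monotoneLowerSpectrum]
  simp only [ENNReal.mul_iSup]
  refine iSup₂_le fun s hs => ?_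
  rw [← ENNReal.ofReal_coe_nnreal, ← ENNReal.ofReal_mul (by linarith)]
  exact ENNReal.ofReal_le_ofReal (H s s.2 hs)

theorem scaledMonotoneLowerSpectrum_eq {X : Type*} [MetricSpace X] {θ v : ℝ}
    (h1 : θ < 1) (hv : 0 ≤ v) (hadm : IsMonotoneLowerExponent X θ (v / (1 - θ)))
    (H : ∀ s, 0 ≤ s → IsMonotoneLowerExponent X θ s → (1 - θ) * s ≤ v) :
    scaledMonotoneLowerSpectrum X θ = ENNReal.ofReal v := by
  refine (scaledMonotoneLowerSpectrum_le h1 H).antisymm ?_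
  have h0 : 0 < 1 - θ := by linarith
  have hnn : 0 ≤ v / (1 - θ) := by positivity
  rw [scaledMonotoneLowerSpectrum, if_neg h1.ne]
  have h2 : ENNReal.ofReal (v / (1 - θ)) ≤ monotoneLowerSpectrum X θ :=
    le_iSup₂_of_le (v / (1 - θ)).toNNReal (by rwa [Real.coe_toNNReal _ hnn]) le_rfl
  calc ENNReal.ofReal v = ENNReal.ofReal (1 - θ) * ENNReal.ofReal (v / (1 - θ)) := by
        rw [← ENNReal.ofReal_mul h0.le]; congr 1; field_simp
    _ ≤ _ := by gcongr

/-- The spectrum of a subset of `ℝ^d` satisfies the monotonicity and growth conditions. -/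
theorem scaled_spectrum_conditions {d : ℕ} {φ : ℝ → ℝ}
    (hφ : ∀ θ ∈ Set.Ioc (0 : ℝ) 1, φ θ ∈ Set.Icc (0 : ℝ) d)
    {F : Set (EuclideanSpace ℝ (Fin d))} (hF : F.Nonempty)
    (h : ∀ θ ∈ Set.Ioc (0 : ℝ) 1, scaledMonotoneLowerSpectrum F θ = ENNReal.ofReal (φ θ)) :
    AntitoneOn (fun θ => φ θ / (1 - θ)) (Set.Ioo 0 1) ∧ φ 1 = 0 ∧
      ∀ l ∈ Set.Ioc (0 : ℝ) 1, ∀ θ ∈ Set.Ioc (0 : ℝ) 1,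
        φ (l * θ) - θ * φ l ≤ (1 - θ) * d := by
  have hone : φ 1 = 0 := by
    have h1 := h 1 (by simp)
    rw [scaledMonotoneLowerSpectrum, if_pos rfl, eq_comm, ENNReal.ofReal_eq_zero] at h1
    exact h1.antisymm (hφ 1 (by simp)).1
  -- The supremum need not be attained, so `adm` and `lub` express separately that it is an upper
  -- bound and the least one.
  have adm : ∀ θ ∈ Set.Ioo (0 : ℝ) 1, ∀ s, IsMonotoneLowerExponent F θ s → (1 - θ) * s ≤ φ θ :=
    fun θ hθ s hs => hs.mul_le_of_scaled_eq hθ.2 (hφ θ ⟨hθ.1, hθ.2.le⟩).1 (h θ ⟨hθ.1, hθ.2.le⟩)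
  have lub : ∀ θ ∈ Set.Ioo (0 : ℝ) 1, ∀ v, 0 ≤ v →
      (∀ s, 0 ≤ s → IsMonotoneLowerExponent F θ s → (1 - θ) * s ≤ v) → φ θ ≤ v := by
    intro θ hθ v hv H
    have h1 := scaledMonotoneLowerSpectrum_le hθ.2 H
    rw [h θ ⟨hθ.1, hθ.2.le⟩] at h1
    exact (ENNReal.ofReal_le_ofReal_iff hv).1 h1
  refine ⟨?_, hone, ?_⟩
  · intro θ hθ θ' hθ' hle
    have hp : 0 < 1 - θ := by linarith [hθ.2]
    have hp' : 0 < 1 - θ' := by linarith [hθ'.2]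
    have hnn := (hφ θ ⟨hθ.1, hθ.2.le⟩).1
    have : φ θ' ≤ (1 - θ') * (φ θ / (1 - θ)) := by
      refine lub θ' hθ' _ (by positivity) fun s _ hs => ?_
      have := adm θ hθ s (isMonotoneLowerExponent_mono hle hθ'.2.le hθ.1 hs)
      gcongr
      rw [le_div_iff₀ hp]; linarith
    change φ θ' / (1 - θ') ≤ φ θ / (1 - θ)
    rw [div_le_iff₀ hp']; linarith
  · intro l hl θ hθ
    rcases eq_or_lt_of_le hθ.2 with rfl | hθ1
    · simp
    have hd : (0 : ℝ) ≤ d := Nat.cast_nonneg d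
    have hp : 0 < 1 - θ := by linarith
    have hl0 := hl.1
    have hθ0 := hθ.1
    have hlθ : l * θ ∈ Set.Ioo (0 : ℝ) 1 := ⟨by positivity, by nlinarith [hl.2]⟩
    have hφl := (hφ l hl).1
    suffices φ (l * θ) ≤ (1 - θ) * d + θ * φ l by linarith
    refine lub _ hlθ _ (by positivity) fun s _ hs => ?_
    -- At `l = 1` there is no spectrum to compare with; by `φ 1 = 0` the claim is the bound of
    -- exponents by `d`.
    rcases eq_or_lt_of_le hl.2 with rfl | hl1
    · rw [one_mul] at hs ⊢
      have := hs.le_dimension hF hθ.1 hθ1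
      rw [hone]
      nlinarith
    · have hq : 0 < θ * (1 - l) := mul_pos hθ.1 (by linarith)
      have e : θ * (1 - l) * ((s * (1 - l * θ) - (1 - θ) * d) / (θ * (1 - l))) =
          s * (1 - l * θ) - (1 - θ) * d := by field_simp
      have := adm l ⟨hl.1, hl1⟩ _ (hs.of_mul hF hl.1 hl1 hθ.1 hθ.2 e)
      nlinarith

/-! ### Two-piece affine functions and their infima -/

theorem twoPieceAffine_of_le {α l t θ : ℝ} (h : θ ≤ l) :
    twoPieceAffine α l t θ = α + θ / l * (t - α) := if_pos h

theorem twoPieceAffine_of_lt {α l t θ : ℝ} (h : l < θ) :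
    twoPieceAffine α l t θ = t * ((1 - θ) / (1 - l)) := if_neg h.not_ge

theorem twoPieceAffine_one {α l t : ℝ} (hl : l ∈ Set.Ioc (0 : ℝ) 1)
    (ht : t ∈ Set.Icc (0 : ℝ) (α * (1 - l))) : twoPieceAffine α l t 1 = 0 := by
  rcases eq_or_lt_of_le hl.2 with rfl | h
  · have : t = 0 := le_antisymm (by simpa using ht.2) ht.1
    simp [twoPieceAffine, this]
  · simp [twoPieceAffine_of_lt h]

/-- The hypothesis `t ≤ α (1 - l)` says that the first segment falls at least as steeply as the line
from `(0, α)` to `(1, 0)`; on the second piece the quotient is constant. -/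
theorem twoPieceAffine_div_antitone {α l t θ θ' : ℝ} (hα : 0 ≤ α) (hl : l ∈ Set.Ioc (0 : ℝ) 1)
    (ht : t ∈ Set.Icc (0 : ℝ) (α * (1 - l))) (h0 : 0 < θ) (hle : θ ≤ θ') (h1 : θ' < 1) :
    twoPieceAffine α l t θ' / (1 - θ') ≤ twoPieceAffine α l t θ / (1 - θ) := by
  have hp : 0 < 1 - θ := by linarith
  have hp' : 0 < 1 - θ' := by linarith
  have hl0 := hl.1
  obtain ⟨ht0, ht1⟩ := ht
  have hle' : t ≤ α := by nlinarith
  have pos : l < θ' → 0 < 1 - l := fun h => by linarith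
  have below : ∀ x, x ≤ l → x < 1 →
      twoPieceAffine α l t x / (1 - x) = (α - x * ((α - t) / l)) / (1 - x) := by
    intro x hx _
    rw [twoPieceAffine_of_le hx]; congr 1; field_simp; ring
  have above : ∀ x, l < x → x < 1 → twoPieceAffine α l t x / (1 - x) = t / (1 - l) := by
    intro x hx hx1
    have h3 : 0 < 1 - x := by linarith
    have h4 : 0 < 1 - l := by linarith
    rw [twoPieceAffine_of_lt hx]; field_simp
  have hslope : α ≤ (α - t) / l := by
    rw [le_div_iff₀ hl0]; linarith
  rcases le_or_gt θ' l with hc | hc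
  · rw [below θ' hc h1, below θ (hle.trans hc) (by linarith), div_le_div_iff₀ hp' hp]
    nlinarith
  · rw [above θ' hc h1]
    rcases le_or_gt θ l with hc' | hc'
    · have h4 := pos hc
      rw [below θ hc' (by linarith), div_le_div_iff₀ h4 hp]
      have e : (α - t) / l * l = α - t := by field_simp
      nlinarith
    · rw [above θ hc' (by linarith)]

theorem twoPieceAffine_mul_le {α l t m θ : ℝ} (hl : l ∈ Set.Ioc (0 : ℝ) 1)
    (ht : t ∈ Set.Icc (0 : ℝ) (α * (1 - l))) (hm : m ∈ Set.Ioc (0 : ℝ) 1)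
    (hθ : θ ∈ Set.Ioc (0 : ℝ) 1) :
    twoPieceAffine α l t (m * θ) ≤ θ * twoPieceAffine α l t m + (1 - θ) * α := by
  obtain ⟨ht0, ht1⟩ := ht
  obtain ⟨hl0, hl1⟩ := hl
  obtain ⟨hm0, hm1⟩ := hm
  obtain ⟨hθ0, hθ1⟩ := hθ
  have hmθ : m * θ ≤ m := by nlinarith
  rcases le_or_gt m l with hc | hc
  · rw [twoPieceAffine_of_le hc, twoPieceAffine_of_le (hmθ.trans hc)]
    apply le_of_eq; field_simp; ring
  · have hp : 0 < 1 - l := by linarith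
    rw [twoPieceAffine_of_lt hc]
    have hu : t / (1 - l) ≤ α := by rwa [div_le_iff₀ hp]
    have e : t / (1 - l) * (1 - l) = t := by field_simp
    have e1 : ∀ x, t * (x / (1 - l)) = t / (1 - l) * x := fun x => by ring
    rw [e1]
    set u := t / (1 - l)
    rcases le_or_gt (m * θ) l with hc' | hc'
    · rw [twoPieceAffine_of_le hc']
      have h5 : m * θ / l * (t - α) ≤ θ * (u * (1 - m) - α) := by
        rw [div_mul_eq_mul_div, div_le_iff₀ hl0]
        -- With `t = u * (1 - l)` this reduces to `(m - l) * (α - u) ≥ 0`.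
        have : m * (t - α) ≤ (u * (1 - m) - α) * l := by nlinarith
        nlinarith
      linarith
    · rw [twoPieceAffine_of_lt hc', e1]
      nlinarith

theorem conditions_iff_isGLB_twoPieceAffine (d : ℕ) (φ : ℝ → ℝ)
    (hφ : ∀ θ ∈ Set.Ioc (0 : ℝ) 1, φ θ ∈ Set.Icc (0 : ℝ) d) :
    (AntitoneOn (fun θ => φ θ / (1 - θ)) (Set.Ioo 0 1) ∧ φ 1 = 0 ∧
        ∀ l ∈ Set.Ioc (0 : ℝ) 1, ∀ θ ∈ Set.Ioc (0 : ℝ) 1,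
          φ (l * θ) - θ * φ l ≤ (1 - θ) * d) ↔
      (∃ S : Set (ℝ × ℝ), S.Nonempty ∧
        (∀ p ∈ S, p.1 ∈ Set.Ioc (0 : ℝ) 1 ∧ p.2 ∈ Set.Icc (0 : ℝ) (d * (1 - p.1))) ∧
        ∀ θ ∈ Set.Ioc (0 : ℝ) 1,
          IsGLB ((fun p : ℝ × ℝ => twoPieceAffine d p.1 p.2 θ) '' S) (φ θ)) := by
  constructor
  · rintro ⟨hanti, hone, hmul⟩
    -- The family of all paths with vertex on the graph of `φ`: the multiplicative condition gives
    -- the majorisation left of the vertex, antitonicity gives it on the right, and the vertex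
    -- itself gives equality.
    refine ⟨(fun l => (l, φ l)) '' Set.Ioc (0 : ℝ) 1, ⟨(1, φ 1), 1, by simp, rfl⟩, ?_, ?_⟩
    · rintro _ ⟨l, hl, rfl⟩
      refine ⟨hl, (hφ l hl).1, ?_⟩
      have := hmul 1 (by simp) l hl
      rw [one_mul, hone] at this
      change φ l ≤ d * (1 - l)
      linarith
    · intro θ hθ
      refine ⟨?_, fun b hb => ?_⟩
      · rintro _ ⟨_, ⟨l, hl, rfl⟩, rfl⟩
        change φ θ ≤ twoPieceAffine d l (φ l) θ
        rcases le_or_gt θ l with hc | hc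
        · rw [twoPieceAffine_of_le hc]
          have h2 := hmul l hl (θ / l) ⟨div_pos hθ.1 hl.1, (div_le_one hl.1).2 hc⟩
          rw [mul_div_cancel₀ _ hl.1.ne'] at h2
          linarith
        · rw [twoPieceAffine_of_lt hc]
          rcases eq_or_lt_of_le hθ.2 with rfl | h1
          · simp [hone]
          · have h2 : φ θ / (1 - θ) ≤ φ l / (1 - l) :=
              hanti ⟨hl.1, hc.trans h1⟩ ⟨hθ.1, h1⟩ hc.le
            rw [div_le_iff₀ (by linarith)] at h2
            refine h2.trans (le_of_eq (by ring))
      · have h2 := hb ⟨_, ⟨θ, hθ, rfl⟩, rfl⟩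
        have hθ0 := hθ.1.ne'
        simpa [twoPieceAffine_of_le, div_self hθ0] using h2
  · rintro ⟨S, ⟨p₀, hp₀⟩, hS, hglb⟩
    have lower : ∀ p ∈ S, ∀ θ ∈ Set.Ioc (0 : ℝ) 1, φ θ ≤ twoPieceAffine d p.1 p.2 θ :=
      fun p hp θ hθ => (hglb θ hθ).1 ⟨p, hp, rfl⟩
    have greatest : ∀ θ ∈ Set.Ioc (0 : ℝ) 1, ∀ b,
        (∀ p ∈ S, b ≤ twoPieceAffine d p.1 p.2 θ) → b ≤ φ θ := by
      intro θ hθ b hb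
      refine (hglb θ hθ).2 ?_
      rintro _ ⟨p, hp, rfl⟩
      exact hb p hp
    refine ⟨?_, ?_, ?_⟩
    · intro θ hθ θ' hθ' hle
      have hp : 0 < 1 - θ := by linarith [hθ.2]
      have hp' : 0 < 1 - θ' := by linarith [hθ'.2]
      change φ θ' / (1 - θ') ≤ φ θ / (1 - θ)
      rw [le_div_iff₀ hp]
      refine greatest θ ⟨hθ.1, hθ.2.le⟩ _ fun p hpS => ?_
      rw [← le_div_iff₀ hp]
      refine le_trans ?_ (twoPieceAffine_div_antitone d.cast_nonneg (hS p hpS).1 (hS p hpS).2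
        hθ.1 hle hθ'.2)
      have := lower p hpS θ' ⟨hθ'.1, hθ'.2.le⟩
      gcongr
    · refine le_antisymm ?_ (hφ 1 (by simp)).1
      rw [← twoPieceAffine_one (hS p₀ hp₀).1 (hS p₀ hp₀).2]
      exact lower p₀ hp₀ 1 (by simp)
    · intro l hl θ hθ
      have hlθ : l * θ ∈ Set.Ioc (0 : ℝ) 1 :=
        ⟨mul_pos hl.1 hθ.1, mul_le_one₀ hl.2 hθ.1.le hθ.2⟩
      have h2 : (φ (l * θ) - (1 - θ) * d) / θ ≤ φ l := by
        refine greatest l hl _ fun p hp => ?_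
        rw [div_le_iff₀ hθ.1]
        have h3 := lower p hp _ hlθ
        have h4 := twoPieceAffine_mul_le (hS p hp).1 (hS p hp).2 hl hθ
        linarith
      rw [div_le_iff₀ hθ.1] at h2
      linarith

/-! ### Sets defined by free binary digits -/

/-- The number with binary digit `1` exactly at the places in `I`. -/
noncomputable def binarySum (I : Finset ℕ) : ℝ := ∑ p ∈ I, (1 / 2 : ℝ) ^ p

/-- The numbers with a finite binary expansion whose digits `1` are at places in `A`. -/
def digitSet (A : Set ℕ) : Set ℝ := {y | ∃ I : Finset ℕ, (I : Set ℕ) ⊆ A ∧ binarySum I = y}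

theorem binarySum_nonneg (I : Finset ℕ) : 0 ≤ binarySum I :=
  Finset.sum_nonneg fun _ _ => by positivity

theorem binarySum_Ioc {m n : ℕ} (h : m ≤ n) :
    binarySum (Finset.Ioc m n) = (1 / 2) ^ m - (1 / 2) ^ n := by
  induction n, h using Nat.le_induction with
  | base => simp [binarySum]
  | succ n hmn ih =>
    rw [binarySum, ← Finset.insert_Ioc_right_eq_Ioc_add_one hmn, Finset.sum_insert (by simp)]
    rw [binarySum] at ih
    rw [ih, pow_succ]; ring

theorem binarySum_mono {I J : Finset ℕ} (h : I ⊆ J) : binarySum I ≤ binarySum J :=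
  Finset.sum_le_sum_of_subset_of_nonneg h fun _ _ _ => by positivity

theorem binarySum_lt {I : Finset ℕ} {m : ℕ} (h : ∀ p ∈ I, m < p) :
    binarySum I < (1 / 2) ^ m := by
  have h1 : I ⊆ Finset.Ioc m (m + I.sup id) := fun p hp => by
    have := Finset.le_sup (f := id) hp
    simp only [id] at this
    exact Finset.mem_Ioc.2 ⟨h p hp, by omega⟩
  have h2 := binarySum_mono h1
  rw [binarySum_Ioc (by omega)] at h2
  have : (0 : ℝ) < (1 / 2) ^ (m + I.sup id) := by positivity
  linarith

theorem binarySum_filter_add (I : Finset ℕ) (q : ℕ → Prop) [DecidablePred q] :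
    binarySum (I.filter q) + binarySum (I.filter fun p => ¬ q p) = binarySum I :=
  Finset.sum_filter_add_sum_filter_not I q _

theorem binarySum_sdiff_sub (I J : Finset ℕ) :
    binarySum (I \ J) - binarySum (J \ I) = binarySum I - binarySum J := by
  have h1 : binarySum (I ∩ J) + binarySum (I \ J) = binarySum I :=
    Finset.sum_inter_add_sum_sdiff I J _
  have h2 : binarySum (J ∩ I) + binarySum (J \ I) = binarySum J :=
    Finset.sum_inter_add_sum_sdiff J I _
  rw [Finset.inter_comm] at h2
  linarith

/-- At the first place `p` where the digits differ one side gains `2 ^ (-p)`, while all later digits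
up to `n` recover at most `2 ^ (-p) - 2 ^ (-n)`. -/
theorem binarySum_separated {I J : Finset ℕ} {n : ℕ} (hI : ∀ p ∈ I, p ≤ n) (hJ : ∀ p ∈ J, p ≤ n)
    (hne : I ≠ J) : (1 / 2 : ℝ) ^ n ≤ |binarySum I - binarySum J| := by
  have aux : ∀ I J : Finset ℕ, (∀ p ∈ J, p ≤ n) → ∀ p ∈ I \ J, (∀ q ∈ J \ I, p < q) → p ≤ n →
      (1 / 2 : ℝ) ^ n ≤ |binarySum I - binarySum J| := by
    intro I J hJ p hp hq hpn
    rw [← binarySum_sdiff_sub]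
    have h1 : (1 / 2 : ℝ) ^ p ≤ binarySum (I \ J) :=
      Finset.single_le_sum (f := fun p => (1 / 2 : ℝ) ^ p) (fun _ _ => by positivity) hp
    have h2 : binarySum (J \ I) ≤ binarySum (Finset.Ioc p n) :=
      binarySum_mono fun q h => Finset.mem_Ioc.2 ⟨hq q h, hJ q (Finset.mem_sdiff.1 h).1⟩
    rw [binarySum_Ioc hpn] at h2
    exact le_trans (by linarith) (le_abs_self _)
  have hs : (symmDiff I J).Nonempty := by
    rw [Finset.nonempty_iff_ne_empty]
    exact fun h => hne (symmDiff_eq_bot.1 h)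
  set p := (symmDiff I J).min' hs with hp
  have hmin : ∀ q ∈ symmDiff I J, p ≤ q := fun q hq => Finset.min'_le _ q hq
  have hmem : p ∈ symmDiff I J := Finset.min'_mem _ hs
  rcases Finset.mem_symmDiff.1 hmem with h | h
  · refine aux I J hJ p (Finset.mem_sdiff.2 h) (fun q hq => ?_) (hI p h.1)
    have hq' := Finset.mem_sdiff.1 hq
    refine lt_of_le_of_ne (hmin q (Finset.mem_symmDiff.2 (Or.inr hq'))) ?_
    rintro e
    exact h.2 (e ▸ hq'.1)
  · rw [abs_sub_comm]
    refine aux J I hI p (Finset.mem_sdiff.2 h) (fun q hq => ?_) (hJ p h.1)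
    have hq' := Finset.mem_sdiff.1 hq
    refine lt_of_le_of_ne (hmin q (Finset.mem_symmDiff.2 (Or.inl hq'))) ?_
    rintro e
    exact h.2 (e ▸ hq'.1)

open Classical in
/-- The number of places of `A` in `(m, n]`. -/
noncomputable def digitCount (A : Set ℕ) (m n : ℕ) : ℕ := ((Finset.Ioc m n).filter (· ∈ A)).card

/-- The digits of `x` outside `(m, n]` are kept, and those at places of `A` in `(m, n]` are chosen
freely. -/
theorem digitSet_separated_points {A : Set ℕ} {x : ℝ} (hx : x ∈ digitSet A) (m n : ℕ) :
    ∃ P : Finset ℝ, (∀ y ∈ P, y ∈ digitSet A ∧ |y - x| ≤ (1 / 2) ^ m) ∧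
      (∀ y ∈ P, ∀ z ∈ P, y ≠ z → (1 / 2 : ℝ) ^ n ≤ |y - z|) ∧ P.card = 2 ^ digitCount A m n := by
  classical
  obtain ⟨I, hI, rfl⟩ := hx
  set q : ℕ → Prop := fun p => m < p ∧ p ≤ n with hq
  set W := (Finset.Ioc m n).filter (· ∈ A) with hW
  set f : Finset ℕ → ℝ := fun J => binarySum (I.filter fun p => ¬ q p) + binarySum J with hf
  have hsub : ∀ J ∈ W.powerset, ∀ p ∈ J, p ∈ A ∧ m < p ∧ p ≤ n := by
    intro J hJ p hp
    have := Finset.mem_powerset.1 hJ hp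
    simp only [hW, Finset.mem_filter, Finset.mem_Ioc] at this
    exact ⟨this.2, this.1⟩
  have hsep : ∀ J ∈ W.powerset, ∀ K ∈ W.powerset, J ≠ K → (1 / 2 : ℝ) ^ n ≤ |f J - f K| := by
    intro J hJ K hK hne
    have := binarySum_separated (fun p hp => (hsub J hJ p hp).2.2)
      (fun p hp => (hsub K hK p hp).2.2) hne
    simpa [hf] using this
  refine ⟨W.powerset.image f, ?_, ?_, ?_⟩
  · intro y hy
    obtain ⟨J, hJ, rfl⟩ := Finset.mem_image.1 hy
    constructor
    · refine ⟨(I.filter fun p => ¬ q p) ∪ J, ?_, ?_⟩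
      · intro p hp
        rcases Finset.mem_union.1 (Finset.mem_coe.1 hp) with h | h
        · exact hI (Finset.mem_filter.1 h).1
        · exact (hsub J hJ p h).1
      · refine Finset.sum_union (Finset.disjoint_left.2 fun p h1 h2 => ?_)
        exact (Finset.mem_filter.1 h1).2 (hsub J hJ p h2).2
    · rw [← binarySum_filter_add I q]
      have h1 := binarySum_nonneg J
      have h2 := binarySum_lt fun p hp => (hsub J hJ p hp).2.1
      have h3 := binarySum_nonneg (I.filter q)
      have h4 := binarySum_lt (I := I.filter q) fun p hp => (Finset.mem_filter.1 hp).2.1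
      rw [abs_le]
      constructor <;> simp only [hf] <;> linarith
  · intro y hy z hz hyz
    obtain ⟨J, hJ, rfl⟩ := Finset.mem_image.1 hy
    obtain ⟨K, hK, rfl⟩ := Finset.mem_image.1 hz
    exact hsep J hJ K hK fun h => hyz (by rw [h])
  · rw [Finset.card_image_of_injOn, Finset.card_powerset, digitCount]
    intro J hJ K hK h
    by_contra hne
    have h1 := hsep J hJ K hK hne
    have h2 : (0 : ℝ) < (1 / 2) ^ n := by positivity
    change f J = f K at h
    rw [h, sub_self, abs_zero] at h1
    linarith

/-- Truncating expansions after place `n` gives the centres. -/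
theorem digitSet_cover {A : Set ℕ} {m : ℕ} (hA : ∀ p ∈ A, m < p) (n : ℕ) :
    ∃ Q : Finset ℝ, Q.card ≤ 2 ^ digitCount A m n ∧ (∀ y ∈ Q, y ∈ digitSet A) ∧
      ∀ y ∈ digitSet A, ∃ z ∈ Q, |y - z| ≤ (1 / 2) ^ n := by
  classical
  set W := (Finset.Ioc m n).filter (· ∈ A) with hW
  refine ⟨W.powerset.image binarySum, ?_, ?_, ?_⟩
  · exact Finset.card_image_le.trans (by rw [Finset.card_powerset, digitCount])
  · intro y hy
    obtain ⟨J, hJ, rfl⟩ := Finset.mem_image.1 hy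
    refine ⟨J, fun p hp => ?_, rfl⟩
    have := Finset.mem_powerset.1 hJ hp
    exact (Finset.mem_filter.1 this).2
  · rintro _ ⟨I, hI, rfl⟩
    refine ⟨_, Finset.mem_image.2 ⟨I.filter (· ≤ n), ?_, rfl⟩, ?_⟩
    · rw [Finset.mem_powerset]
      intro p hp
      obtain ⟨hp1, hp2⟩ := Finset.mem_filter.1 hp
      have := hI hp1
      simp [hW, hp2, this, hA p this]
    · rw [← binarySum_filter_add I (· ≤ n), add_sub_cancel_left,
        abs_of_nonneg (binarySum_nonneg _)]
      exact (binarySum_lt fun p hp => not_le.1 (Finset.mem_filter.1 hp).2).le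

theorem digitSet_bounds {A : Set ℕ} {m : ℕ} (hA : ∀ p ∈ A, m < p) {y : ℝ} (hy : y ∈ digitSet A) :
    0 ≤ y ∧ y < (1 / 2) ^ m := by
  obtain ⟨I, hI, rfl⟩ := hy
  exact ⟨binarySum_nonneg I, binarySum_lt fun p hp => hA p (hI hp)⟩

theorem zero_mem_digitSet (A : Set ℕ) : (0 : ℝ) ∈ digitSet A := ⟨∅, by simp, by simp [binarySum]⟩

/-! ### Counting free digits -/

theorem digitCount_succ_le (A : Set ℕ) (m n : ℕ) :
    digitCount A m (n + 1) ≤ digitCount A m n + 1 := by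
  classical
  have : (Finset.Ioc m (n + 1)).filter (· ∈ A) ⊆
      insert (n + 1) ((Finset.Ioc m n).filter (· ∈ A)) := by
    intro p
    simp only [Finset.mem_filter, Finset.mem_Ioc, Finset.mem_insert]
    rintro ⟨⟨h1, h2⟩, h3⟩
    rcases Nat.lt_or_ge n p with h | h
    · left; omega
    · right; exact ⟨⟨h1, h⟩, h3⟩
  exact (Finset.card_le_card this).trans (Finset.card_insert_le _ _)

theorem digitCount_add_le (A : Set ℕ) (m n k : ℕ) :
    digitCount A m (n + k) ≤ digitCount A m n + k := by
  induction k with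
  | zero => simp
  | succ k ih => exact (digitCount_succ_le A m (n + k)).trans (by omega)

theorem digitCount_congr {A B : Set ℕ} {m n : ℕ} (h : ∀ p, m < p → p ≤ n → (p ∈ A ↔ p ∈ B)) :
    digitCount A m n = digitCount B m n := by
  classical
  unfold digitCount
  congr 1
  refine Finset.filter_congr fun p hp => ?_
  rw [Finset.mem_Ioc] at hp
  exact h p hp.1 hp.2

theorem digitCount_of_forall {A : Set ℕ} {m n : ℕ} (h : ∀ p, m < p → p ≤ n → p ∈ A) :
    digitCount A m n = n - m := by
  classical
  rw [digitCount, Finset.filter_true_of_mem, Nat.card_Ioc]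
  intro p hp
  rw [Finset.mem_Ioc] at hp
  exact h p hp.1 hp.2

theorem digitCount_add {A : Set ℕ} {m n k : ℕ} (h : m ≤ n) (h' : n ≤ k) :
    digitCount A m k = digitCount A m n + digitCount A n k := by
  classical
  unfold digitCount
  rw [← Finset.card_union_of_disjoint, ← Finset.filter_union, Finset.Ioc_union_Ioc_eq_Ioc h h']
  refine Finset.disjoint_filter_filter (Finset.disjoint_left.2 fun p => ?_)
  simp only [Finset.mem_Ioc]
  omega

/-- A set of places of density `α`. -/
def densitySet (α : ℝ) : Set ℕ := {p | ⌊((p : ℝ) - 1) * α⌋₊ < ⌊(p : ℝ) * α⌋₊}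

/-- The places are the jumps of `⌊p α⌋`, each of height one because `α ≤ 1`, so the count
telescopes. -/
theorem digitCount_densitySet {α : ℝ} (h0 : 0 ≤ α) (h1 : α ≤ 1) {m n : ℕ} (h : m ≤ n) :
    ⌊(m : ℝ) * α⌋₊ + digitCount (densitySet α) m n = ⌊(n : ℝ) * α⌋₊ := by
  classical
  induction n, h using Nat.le_induction with
  | base => simp [digitCount]
  | succ n hmn ih =>
    have hs : ⌊((n + 1 : ℕ) : ℝ) * α⌋₊ ≤ ⌊(n : ℝ) * α⌋₊ + 1 := by
      rw [← Nat.floor_add_one (by positivity)]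
      apply Nat.floor_le_floor
      push_cast; nlinarith
    have hs' : ⌊(n : ℝ) * α⌋₊ ≤ ⌊((n + 1 : ℕ) : ℝ) * α⌋₊ := by
      apply Nat.floor_le_floor
      push_cast; nlinarith
    have hmem : n + 1 ∈ densitySet α ↔ ⌊(n : ℝ) * α⌋₊ < ⌊((n + 1 : ℕ) : ℝ) * α⌋₊ := by
      simp [densitySet]
    rw [digitCount_add hmn (by omega : n ≤ n + 1), ← add_assoc, ih]
    by_cases hc : n + 1 ∈ densitySet α
    · rw [digitCount_of_forall]
      · have := hmem.1 hc; omega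
      · intro p hp1 hp2
        obtain rfl : p = n + 1 := by omega
        exact hc
    · have : digitCount (densitySet α) n (n + 1) = 0 := by
        rw [digitCount, Finset.card_eq_zero, Finset.filter_eq_empty_iff]
        intro p hp
        rw [Finset.mem_Ioc] at hp
        obtain rfl : p = n + 1 := by omega
        exact hc
      have := mt hmem.2 hc
      omega

theorem le_digitCount_densitySet {α : ℝ} (h0 : 0 ≤ α) (h1 : α ≤ 1) {m n : ℕ} (h : m ≤ n) :
    α * (n - m) ≤ digitCount (densitySet α) m n + 1 := by
  have h2 : (⌊(m : ℝ) * α⌋₊ : ℝ) + digitCount (densitySet α) m n = ⌊(n : ℝ) * α⌋₊ := by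
    exact_mod_cast digitCount_densitySet h0 h1 h
  have h3 := Nat.lt_floor_add_one ((n : ℝ) * α)
  have h4 := Nat.floor_le (a := (m : ℝ) * α) (by positivity)
  linarith

theorem digitCount_densitySet_le {α : ℝ} (h0 : 0 ≤ α) (h1 : α ≤ 1) {m n : ℕ} (h : m ≤ n) :
    (digitCount (densitySet α) m n : ℝ) ≤ α * (n - m) + 1 := by
  have h2 : (⌊(m : ℝ) * α⌋₊ : ℝ) + digitCount (densitySet α) m n = ⌊(n : ℝ) * α⌋₊ := by
    exact_mod_cast digitCount_densitySet h0 h1 h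
  have h3 := Nat.lt_floor_add_one ((m : ℝ) * α)
  have h4 := Nat.floor_le (a := (n : ℝ) * α) (by positivity)
  linarith

/-- Places beyond `a`, of density `α` up to `b` and all of them from there on. -/
def thinnedSet (a b : ℕ) (α : ℝ) : Set ℕ := {p | b < p ∨ (a < p ∧ p ≤ b ∧ p ∈ densitySet α)}

theorem lt_of_mem_thinnedSet {a b : ℕ} (hab : a < b) {α : ℝ} {p : ℕ} (hp : p ∈ thinnedSet a b α) :
    a < p := by
  rcases hp with h | h
  · omega
  · exact h.1

/-- The scales from `2 ^ (-a)` to `2 ^ (-b)` are those where the piece is thin; this count gives the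
upper bound for the spectrum. -/
theorem digitCount_thinnedSet_le {a b : ℕ} (hab : a < b) {α : ℝ} (h0 : 0 ≤ α) (h1 : α ≤ 1) :
    (digitCount (thinnedSet a b α) a b : ℝ) ≤ α * (b - a) + 1 := by
  rw [digitCount_congr (B := densitySet α)]
  · exact digitCount_densitySet_le h0 h1 hab.le
  · intro p hp1 hp2
    simp [thinnedSet, hp1, hp2, hp2.not_gt]

/-- Here `hle` says, with `q = a / b`, that `(1 - θ) σ` lies below the segment from `(0, 1)` to `(q,
(1 - q) α)`. It is needed when the window `(m, n]` straddles `b`; the worst window is then `m = a`,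
`n = a / θ`. -/
theorem le_digitCount_thinnedSet {a b : ℕ} (ha : 0 < a) (hab : a < b) {α : ℝ} (h0 : 0 ≤ α)
    (h1 : α ≤ 1) {θ σ : ℝ} (hθ0 : 0 < θ) (hθ1 : θ < 1) (hσ1 : σ ≤ 1)
    (hge : (a : ℝ) / b ≤ θ → σ ≤ α)
    (hle : θ ≤ (a : ℝ) / b → (1 - θ) * σ ≤ 1 - θ / (a / b) * (1 - (1 - a / b) * α))
    {m n : ℕ} (ham : a ≤ m) (hmn : (m : ℝ) ≤ θ * n) :
    σ * (n - m) ≤ digitCount (thinnedSet a b α) m n + 1 := by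
  have hle' : (m : ℝ) ≤ n := hmn.trans (by nlinarith [(Nat.cast_nonneg n : (0 : ℝ) ≤ n)])
  have hle'' : m ≤ n := by exact_mod_cast hle'
  have ha' : (0 : ℝ) < a := by exact_mod_cast ha
  have hb' : (0 : ℝ) < b := by exact_mod_cast (ha.trans hab)
  have ham' : (a : ℝ) ≤ m := by exact_mod_cast ham
  have full : ∀ {m}, b ≤ m → m ≤ n →
      (digitCount (thinnedSet a b α) m n : ℝ) = n - m := by
    intro m h h'
    rw [digitCount_of_forall, Nat.cast_sub h']
    exact fun p hp _ => Or.inl (by omega)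
  have thin : ∀ {n}, m ≤ n → n ≤ b →
      α * (n - m) ≤ digitCount (thinnedSet a b α) m n + 1 := by
    intro n h h'
    rw [digitCount_congr (B := densitySet α)]
    · exact le_digitCount_densitySet h0 h1 h
    · intro p hp1 hp2
      have e1 : a < p := by omega
      have e2 : p ≤ b := by omega
      simp [thinnedSet, e1, e2, e2.not_gt]
  -- The window lies beyond `b`, or before `b` (forcing `a / b ≤ θ`), or straddles `b`.
  rcases le_or_gt b m with hbm | hbm
  · rw [full hbm hle'']
    nlinarith
  · have hbm' : (m : ℝ) ≤ b := by exact_mod_cast hbm.le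
    rcases le_or_gt n b with hnb | hnb
    · refine le_trans ?_ (thin hle'' hnb)
      have hnb' : (n : ℝ) ≤ b := by exact_mod_cast hnb
      refine mul_le_mul_of_nonneg_right (hge ?_) (by linarith)
      rw [div_le_iff₀ hb']
      nlinarith
    · have e := digitCount_add (A := thinnedSet a b α) hbm.le hnb.le
      have e' : (digitCount (thinnedSet a b α) m n : ℝ) =
        digitCount (thinnedSet a b α) m b + digitCount (thinnedSet a b α) b n := by
          exact_mod_cast e
      have h2 := thin hbm.le le_rfl
      have hnb' : (b : ℝ) ≤ n := by exact_mod_cast hnb.le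
      rw [e', full le_rfl hnb.le]
      suffices σ * (n - m) ≤ α * (b - m) + (n - b) by linarith
      rcases le_total ((a : ℝ) / b) θ with hc | hc
      · have := hge hc
        nlinarith
      · have h3 := hle hc
        have e1 : θ / ((a : ℝ) / b) * (1 - (1 - a / b) * α) * a = θ * (b - (b - a) * α) := by
          field_simp
        -- This is the extremal case `m = a`. In `h5` the difference of the two sides is affine in
        -- `m` with slope `1 - θ α - (1 - θ) σ ≥ 0`, so the bound extends to `m ≥ a`.
        have h4 : (1 - θ) * σ * a ≤ a - θ * (b - (b - a) * α) := by
          have := mul_le_mul_of_nonneg_right h3 ha'.le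
          linarith
        have h5 : (1 - θ) * σ * m ≤ m - θ * (b - (b - m) * α) := by
          have hs : 0 ≤ 1 - θ * α - (1 - θ) * σ := by nlinarith
          nlinarith [mul_nonneg (sub_nonneg.2 ham') hs]
        refine le_of_mul_le_mul_left ?_ hθ0
        nlinarith

/-! ### Products of subsets of the line -/

/-- The points of `ℝ^d` with all coordinates in `S`. -/
def coordinateSet (d : ℕ) (S : Set ℝ) : Set (EuclideanSpace ℝ (Fin d)) := {x | ∀ i, x i ∈ S}

theorem euclidean_dist_le {d : ℕ} {x y : EuclideanSpace ℝ (Fin d)} {c : ℝ} (hc : 0 ≤ c)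
    (h : ∀ i, |x i - y i| ≤ c) : dist x y ≤ (d + 1) * c := by
  rw [EuclideanSpace.dist_eq]
  refine Real.sqrt_le_iff.2 ⟨by positivity, ?_⟩
  calc ∑ i, dist (x i) (y i) ^ 2 ≤ ∑ _i : Fin d, c ^ 2 :=
        Finset.sum_le_sum fun i _ => pow_le_pow_left₀ dist_nonneg (h i) 2
    _ = d * c ^ 2 := by simp
    _ ≤ ((d + 1) * c) ^ 2 := by
        rw [mul_pow]
        have : (0 : ℝ) ≤ d := Nat.cast_nonneg d
        exact mul_le_mul_of_nonneg_right (by nlinarith) (by positivity)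

theorem abs_sub_le_euclidean_dist {d : ℕ} (x y : EuclideanSpace ℝ (Fin d)) (i : Fin d) :
    |x i - y i| ≤ dist x y := by
  rw [dist_eq_norm, ← Real.norm_eq_abs]
  exact PiLp.norm_apply_le (x - y) i

/-- Distinct points of the product grid differ by at least `ε > 2 r` in some coordinate, so no ball
of the cover contains two of them. -/
theorem prod_card_le_card_cover {d : ℕ} {S : Set ℝ} {x : coordinateSet d S} {r R ε δ : ℝ}
    (hε : 2 * r < ε) (hδ0 : 0 ≤ δ) (hδ : (d + 1) * δ ≤ R) (P : Fin d → Finset ℝ)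
    (hP : ∀ i, ∀ y ∈ P i, y ∈ S ∧ |y - x.1 i| ≤ δ)
    (hsep : ∀ i, ∀ y ∈ P i, ∀ z ∈ P i, y ≠ z → ε ≤ |y - z|)
    (D : Finset (coordinateSet d S))
    (hD : ∀ z ∈ Metric.closedBall x R, ∃ y ∈ D, dist z y ≤ r) :
    ∏ i, (P i).card ≤ D.card := by
  classical
  have hmem : ∀ p ∈ Fintype.piFinset P, ∃ y ∈ D, dist (WithLp.toLp 2 p) y.1 ≤ r := by
    intro p hp
    have hpi := fun i => hP i (p i) (Fintype.mem_piFinset.1 hp i)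
    refine hD ⟨WithLp.toLp 2 p, fun i => (hpi i).1⟩ ?_
    exact (euclidean_dist_le hδ0 fun i => (hpi i).2).trans hδ
  have : Nonempty (coordinateSet d S) := ⟨x⟩
  choose! f hf hfr using hmem
  rw [← Fintype.card_piFinset]
  refine Finset.card_le_card_of_injOn f (fun p hp => hf p hp) fun p hp q hq hpq => ?_
  funext i
  by_contra hne
  have h1 := hsep i _ (Fintype.mem_piFinset.1 hp i) _ (Fintype.mem_piFinset.1 hq i) hne
  have h2 := abs_sub_le_euclidean_dist (WithLp.toLp 2 p) (WithLp.toLp 2 q) i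
  have h3 := hfr p hp
  have h4 := hfr q hq
  rw [← hpq] at h4
  have h5 := dist_triangle_right (WithLp.toLp 2 p) (WithLp.toLp 2 q) (f p).1
  change |p i - q i| ≤ _ at h2
  linarith

theorem exists_cover_coordinateSet {d : ℕ} {S : Set ℝ} {x : coordinateSet d S} {R δ : ℝ}
    (hδ0 : 0 ≤ δ) (Q : Fin d → Finset ℝ) (hQ : ∀ i, ∀ y ∈ Q i, y ∈ S)
    (hc : ∀ i, ∀ y ∈ S, |y - x.1 i| ≤ R → ∃ z ∈ Q i, |y - z| ≤ δ) :
    ∃ D : Finset (coordinateSet d S), D.card ≤ ∏ i, (Q i).card ∧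
      ∀ z ∈ Metric.closedBall x R, ∃ y ∈ D, dist z y ≤ (d + 1) * δ := by
  classical
  refine ⟨(Fintype.piFinset Q).attach.image fun p => ⟨WithLp.toLp 2 p.1, fun i =>
    hQ i _ (Fintype.mem_piFinset.1 p.2 i)⟩, ?_, ?_⟩
  · refine Finset.card_image_le.trans ?_
    rw [Finset.card_attach, Fintype.card_piFinset]
  · intro z hz
    choose q hq hzq using fun i => hc i (z.1 i) (z.2 i)
      ((abs_sub_le_euclidean_dist z.1 x.1 i).trans hz)
    refine ⟨_, Finset.mem_image.2 ⟨⟨q, Fintype.mem_piFinset.2 hq⟩, Finset.mem_attach _ _, rfl⟩, ?_⟩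
    exact euclidean_dist_le hδ0 hzq

/-! ### The thinned line and its spectrum -/

/-- For each `0 < a < b`, a copy of the dyadic rationals in `[0, 1)` together with, at distance
comparable to `2 ^ (-a)` from it, a set of diameter `2 ^ (-a)` which has dimension `α a b` at
scales between `2 ^ (-b)` and `2 ^ (-a)` and dimension `1` at smaller scales. -/
def thinnedLine (α : ℕ → ℕ → ℝ) : Set ℝ :=
  {y | ∃ a b : ℕ, 0 < a ∧ a < b ∧ (y - 10 * (Nat.pair a b : ℝ) ∈ digitSet (Set.Ioi 0) ∨
    y - (10 * (Nat.pair a b : ℝ) - 3 * (1 / 2) ^ a) ∈ digitSet (thinnedSet a b (α a b)))}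

theorem separated_points_of_translate {A : Set ℕ} {S : Set ℝ} {t x : ℝ}
    (hS : ∀ y, y - t ∈ digitSet A → y ∈ S) (hx : x - t ∈ digitSet A) (m n : ℕ) :
    ∃ P : Finset ℝ, (∀ y ∈ P, y ∈ S ∧ |y - x| ≤ (1 / 2) ^ m) ∧
      (∀ y ∈ P, ∀ z ∈ P, y ≠ z → (1 / 2 : ℝ) ^ n ≤ |y - z|) ∧ P.card = 2 ^ digitCount A m n := by
  obtain ⟨P, h1, h2, h3⟩ := digitSet_separated_points hx m n
  refine ⟨P.map (addRightEmbedding t), ?_, ?_, by rw [Finset.card_map, h3]⟩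
  · intro y hy
    obtain ⟨y, hyP, rfl⟩ := Finset.mem_map.1 hy
    simp only [addRightEmbedding_apply] at hy ⊢
    refine ⟨hS _ (by simpa using (h1 y hyP).1), ?_⟩
    convert (h1 y hyP).2 using 2; ring
  · intro y hy z hz hyz
    obtain ⟨y, hyP, rfl⟩ := Finset.mem_map.1 hy
    obtain ⟨z, hzP, rfl⟩ := Finset.mem_map.1 hz
    simp only [addRightEmbedding_apply] at hyz ⊢
    rw [add_sub_add_right_eq_sub]
    exact h2 y hyP z hzP fun h => hyz (by rw [h])

/-- The slack `k` lets the condition relating `m` and `n` fail by a bounded amount: digits are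
counted up to place `n + k`, and at most `k` of them are then dropped. -/
theorem thinnedLine_separated_points {α : ℕ → ℕ → ℝ} {θ σ : ℝ}
    (h0 : ∀ a b, 0 ≤ α a b) (h1 : ∀ a b, α a b ≤ 1)
    (hθ0 : 0 < θ) (hθ1 : θ < 1) (hσ0 : 0 ≤ σ) (hσ1 : σ ≤ 1)
    (hge : ∀ a b : ℕ, 0 < a → a < b → (a : ℝ) / b ≤ θ → σ ≤ α a b)
    (hle : ∀ a b : ℕ, 0 < a → a < b → θ ≤ (a : ℝ) / b →
      (1 - θ) * σ ≤ 1 - θ / (a / b) * (1 - (1 - a / b) * α a b))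
    {x : ℝ} (hx : x ∈ thinnedLine α) {m n k : ℕ} (hm : (m : ℝ) + 2 ≤ θ * (n + k)) :
    ∃ (P : Finset ℝ) (c : ℕ), (∀ y ∈ P, y ∈ thinnedLine α ∧ |y - x| ≤ (1 / 2) ^ m) ∧
      (∀ y ∈ P, ∀ z ∈ P, y ≠ z → (1 / 2 : ℝ) ^ n ≤ |y - z|) ∧ P.card = 2 ^ c ∧
      σ * (n + k - m) ≤ c + k + 4 := by
  obtain ⟨a, b, ha, hab, hx⟩ := hx
  have hnk : (0 : ℝ) ≤ (n : ℝ) + k := by positivity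
  have hmnk : (m : ℝ) + 2 ≤ n + k := hm.trans (by nlinarith)
  have hsub : ∀ y, y - 10 * (Nat.pair a b : ℝ) ∈ digitSet (Set.Ioi 0) → y ∈ thinnedLine α :=
    fun y hy => ⟨a, b, ha, hab, Or.inl hy⟩
  have hsub' : ∀ y, y - (10 * (Nat.pair a b : ℝ) - 3 * (1 / 2) ^ a) ∈
      digitSet (thinnedSet a b (α a b)) → y ∈ thinnedLine α :=
    fun y hy => ⟨a, b, ha, hab, Or.inr hy⟩
  have hfull : ∀ j : ℕ, j ≤ m + 1 →
      σ * (n + k - m) ≤ (digitCount (Set.Ioi 0) j n : ℕ) + k + 4 := by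
    intro j hj
    rw [digitCount_of_forall fun p hp _ => Set.mem_Ioi.2 (by omega)]
    have h2 : (n : ℝ) ≤ (n - j : ℕ) + j := by exact_mod_cast (by omega : n ≤ n - j + j)
    have h3 : (j : ℝ) ≤ m + 1 := by exact_mod_cast hj
    nlinarith
  have hthin : ∀ j : ℕ, a ≤ j → m ≤ j → j ≤ m + 2 →
      σ * (n + k - m) ≤ (digitCount (thinnedSet a b (α a b)) j n : ℕ) + k + 4 := by
    intro j haj hmj hj
    have hj' : (j : ℝ) ≤ m + 2 := by exact_mod_cast hj
    have h2 := le_digitCount_thinnedSet ha hab (h0 a b) (h1 a b) hθ0 hθ1 hσ1 (hge a b ha hab)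
      (hle a b ha hab) haj (n := n + k) (by push_cast; linarith)
    have h3 : (digitCount (thinnedSet a b (α a b)) j (n + k) : ℝ) ≤
        digitCount (thinnedSet a b (α a b)) j n + k := by
      exact_mod_cast digitCount_add_le _ j n k
    push_cast at h2
    nlinarith
  rcases hx with hx | hx
  · obtain ⟨P, h2, h3, h4⟩ := separated_points_of_translate hsub hx m n
    exact ⟨P, _, h2, h3, h4, hfull m (by omega)⟩
  · rcases le_or_gt a (m + 2) with hc | hc
    · obtain ⟨P, h2, h3, h4⟩ := separated_points_of_translate hsub' hx (max a m) n
      refine ⟨P, _, fun y hy => ⟨(h2 y hy).1, (h2 y hy).2.trans ?_⟩, h3, h4,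
        hthin (max a m) (le_max_left _ _) (le_max_right _ _) (by omega)⟩
      exact pow_le_pow_of_le_one (by norm_num) (by norm_num) (le_max_right _ _)
    · obtain ⟨P, h2, h3, h4⟩ := separated_points_of_translate hsub
        (x := 10 * (Nat.pair a b : ℝ)) (by simpa using zero_mem_digitSet _) (m + 1) n
      refine ⟨P, _, fun y hy => ⟨(h2 y hy).1, ?_⟩, h3, h4, hfull (m + 1) le_rfl⟩
      have h5 := (h2 y hy).2
      obtain ⟨h6, h7⟩ := digitSet_bounds (fun p => lt_of_mem_thinnedSet hab) hx
      have h8 : (1 / 2 : ℝ) ^ a ≤ (1 / 2) ^ (m + 3) :=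
        pow_le_pow_of_le_one (by norm_num) (by norm_num) (by omega)
      have h9 : (0 : ℝ) < (1 / 2) ^ a := by positivity
      rw [pow_succ] at h5
      rw [pow_succ, pow_succ, pow_succ] at h8
      rw [abs_le] at h5 ⊢
      constructor <;> linarith

/-- The multiples of `10` keep different pairs apart, and the offset `3 * 2 ^ (-a)` keeps the full
copy out of this ball. -/
theorem thinnedLine_near {α : ℕ → ℕ → ℝ} {a b : ℕ} (ha : 0 < a) (hab : a < b) {y : ℝ}
    (hy : y ∈ thinnedLine α)
    (h : |y - (10 * (Nat.pair a b : ℝ) - 3 * (1 / 2) ^ a)| ≤ (1 / 2) ^ a) :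
    y - (10 * (Nat.pair a b : ℝ) - 3 * (1 / 2) ^ a) ∈ digitSet (thinnedSet a b (α a b)) := by
  have half : ∀ {c : ℕ}, 0 < c → (0 : ℝ) < (1 / 2) ^ c ∧ (1 / 2 : ℝ) ^ c ≤ 1 / 2 := by
    intro c hc
    refine ⟨by positivity, ?_⟩
    simpa using pow_le_pow_of_le_one (by norm_num : (0 : ℝ) ≤ 1 / 2) (by norm_num) hc
  obtain ⟨a', b', ha', hab', hy⟩ := hy
  obtain ⟨p1, p2⟩ := half ha
  obtain ⟨p1', p2'⟩ := half ha'
  have hrange : |y - 10 * (Nat.pair a' b' : ℝ)| ≤ 3 / 2 := by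
    rw [abs_le]
    rcases hy with hy | hy
    · obtain ⟨h1, h2⟩ := digitSet_bounds (m := 0) (fun p hp => hp) hy
      constructor <;> linarith
    · obtain ⟨h1, h2⟩ := digitSet_bounds (fun p => lt_of_mem_thinnedSet hab') hy
      constructor <;> linarith
  rw [abs_le] at h hrange
  have heq : Nat.pair a' b' = Nat.pair a b := by
    by_contra hne
    rcases Nat.lt_or_gt_of_ne hne with hlt | hlt
    · have : (Nat.pair a' b' : ℝ) + 1 ≤ Nat.pair a b := by exact_mod_cast hlt
      linarith
    · have : (Nat.pair a b : ℝ) + 1 ≤ Nat.pair a' b' := by exact_mod_cast hlt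
      linarith
  obtain ⟨rfl, rfl⟩ := Nat.pair_eq_pair.1 heq
  rcases hy with hy | hy
  · obtain ⟨h1, -⟩ := digitSet_bounds (m := 0) (fun p hp => hp) hy
    linarith
  · exact hy

theorem isMonotoneLowerExponent_thinnedLine (d : ℕ) {α : ℕ → ℕ → ℝ} {θ σ : ℝ}
    (h0 : ∀ a b, 0 ≤ α a b) (h1 : ∀ a b, α a b ≤ 1)
    (hθ0 : 0 < θ) (hθ1 : θ < 1) (hσ0 : 0 ≤ σ) (hσ1 : σ ≤ 1)
    (hge : ∀ a b : ℕ, 0 < a → a < b → (a : ℝ) / b ≤ θ → σ ≤ α a b)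
    (hle : ∀ a b : ℕ, 0 < a → a < b → θ ≤ (a : ℝ) / b →
      (1 - θ) * σ ≤ 1 - θ / (a / b) * (1 - (1 - a / b) * α a b)) :
    IsMonotoneLowerExponent (coordinateSet d (thinnedLine α)) θ (d * σ) := by
  rw [isMonotoneLowerExponent_iff]
  -- `2 ^ e` absorbs the factor `d + 1` between boxes and balls; `k` compensates for the resulting
  -- shift of `m` and for rounding.
  obtain ⟨e, he⟩ := exists_nat_ge (Real.logb 2 (d + 1))
  obtain ⟨k, hk⟩ := exists_nat_ge ((e + 4) / θ + e + 4)
  refine ⟨2 ^ (-(d * (k + 4) : ℝ)), by positivity, fun r R hr hrθ hR hR1 x D hD => ?_⟩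
  have hr1 : r < 1 := by linarith
  have hR0 : 0 < R := hr.trans_le (hrθ.trans hR)
  have hrR : r ≤ R := hrθ.trans hR
  set ρ := -Real.logb 2 r with hρ
  set τ := -Real.logb 2 R with hτ
  have hr2 : r = 2 ^ (-ρ) := by simp [hρ, Real.rpow_logb two_pos (by norm_num) hr]
  have hR2 : R = 2 ^ (-τ) := by simp [hτ, Real.rpow_logb two_pos (by norm_num) hR0]
  have hτ0 : 0 < τ := by
    have := Real.logb_neg one_lt_two hR0 hR1
    linarith
  have hτρ : τ ≤ θ * ρ := by
    rw [hr2, hR2, ← Real.rpow_mul two_pos.le, Real.rpow_le_rpow_left_iff one_lt_two] at hR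
    linarith
  have hρτ : τ ≤ ρ := by nlinarith
  have hRr : R / r = 2 ^ (ρ - τ) := by
    rw [hr2, hR2, ← Real.rpow_sub two_pos]; congr 1; ring
  have hgoal : ∀ v : ℝ, d * (σ * (ρ - τ)) ≤ v + d * (k + 4) → (2 : ℝ) ^ v ≤ D.card →
      (2 : ℝ) ^ (-(d * (k + 4) : ℝ)) * (R / r) ^ (d * σ) ≤ D.card := by
    intro v hv hvD
    refine le_trans ?_ hvD
    rw [hRr, ← Real.rpow_mul two_pos.le, ← Real.rpow_add two_pos,
      Real.rpow_le_rpow_left_iff one_lt_two]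
    linarith
  have hd : (0 : ℝ) ≤ d := Nat.cast_nonneg d
  have hk1 : (0 : ℝ) ≤ (e + 4) / θ + e := by positivity
  rcases le_or_gt ρ 1 with hρ1 | hρ1
  · refine hgoal 0 ?_ ?_
    · rw [zero_add]
      refine mul_le_mul_of_nonneg_left ?_ hd
      nlinarith
    · rw [Real.rpow_zero]
      obtain ⟨y, hy, -⟩ := hD x (Metric.mem_closedBall_self hR0.le)
      exact_mod_cast Finset.card_pos.2 ⟨y, hy⟩
  · set n := ⌈ρ⌉₊ - 2 with hn
    set m := ⌈τ⌉₊ + e with hm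
    have hn1 : (n : ℝ) < ρ - 1 := by
      have h2 : ⌈ρ⌉₊ < ρ + 1 := Nat.ceil_lt_add_one (by linarith)
      have h3 : 2 ≤ ⌈ρ⌉₊ := Nat.lt_ceil.2 (by exact_mod_cast hρ1)
      rw [hn, Nat.cast_sub h3]
      push_cast; linarith
    have hn2 : ρ ≤ n + 2 := by
      have h2 := Nat.le_ceil ρ
      have h3 : (⌈ρ⌉₊ : ℝ) ≤ (n : ℝ) + 2 := by exact_mod_cast (by omega : ⌈ρ⌉₊ ≤ n + 2)
      linarith
    have hm1 : τ + e ≤ m := by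
      rw [hm]; push_cast; linarith [Nat.le_ceil τ]
    have hm2 : (m : ℝ) ≤ τ + e + 1 := by
      rw [hm]; push_cast; linarith [Nat.ceil_lt_add_one hτ0.le]
    have hmnk : (m : ℝ) + 2 ≤ θ * (n + k) := by
      have h2 : θ * ((e + 4) / θ + e + 4) = e + 4 + θ * (e + 4) := by field_simp; ring
      have h3 := mul_le_mul_of_nonneg_left hk hθ0.le
      have h4 := mul_le_mul_of_nonneg_left hn2 hθ0.le
      have h5 : 0 ≤ θ * e := by positivity
      nlinarith
    choose P c hP hsep hcard hc using fun i => thinnedLine_separated_points h0 h1 hθ0 hθ1 hσ0 hσ1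
      hge hle (x.2 i) hmnk
    have half : ∀ j : ℕ, (1 / 2 : ℝ) ^ j = 2 ^ (-(j : ℝ)) := by
      intro j
      rw [Real.rpow_neg two_pos.le, Real.rpow_natCast, one_div, inv_pow]
    have hcov := prod_card_le_card_cover (r := r) (R := R) (ε := (1 / 2) ^ n) (δ := (1 / 2) ^ m)
      ?_ (by positivity) ?_ P hP hsep D hD
    · simp only [hcard, Finset.prod_pow_eq_pow_sum] at hcov
      refine hgoal ((∑ i, c i : ℕ) : ℝ) ?_ ?_
      · push_cast
        have h2 : ∑ i : Fin d, (σ * (ρ - τ)) ≤ ∑ i : Fin d, ((c i : ℝ) + (k + 4)) := by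
          refine Finset.sum_le_sum fun i _ => ?_
          have h3 := hc i
          have h4 : σ * (ρ - τ) ≤ σ * (n + k - m) := by
            refine mul_le_mul_of_nonneg_left ?_ hσ0
            have : (0 : ℝ) ≤ (e + 4) / θ := by positivity
            linarith
          linarith
        rw [Finset.sum_add_distrib] at h2
        simpa only [Finset.sum_const, Finset.card_univ, Fintype.card_fin, nsmul_eq_mul] using h2
      · rw [Real.rpow_natCast]
        exact_mod_cast hcov
    · rw [half, hr2]
      calc (2 : ℝ) * 2 ^ (-ρ) = 2 ^ (1 - ρ) := by
            rw [sub_eq_add_neg, Real.rpow_add two_pos, Real.rpow_one]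
        _ < _ := by
            rw [Real.rpow_lt_rpow_left_iff one_lt_two]; linarith
    · rw [half, hR2]
      calc ((d : ℝ) + 1) * 2 ^ (-(m : ℝ)) ≤ 2 ^ (e : ℝ) * 2 ^ (-(m : ℝ)) := by
            gcongr
            rwa [← Real.logb_le_iff_le_rpow one_lt_two (by positivity)]
        _ = 2 ^ (e - m : ℝ) := by rw [← Real.rpow_add two_pos]; rfl
        _ ≤ _ := by
            rw [Real.rpow_le_rpow_left_iff one_lt_two]; linarith

/-- The pieces `(k a, k b)` share the density `u`, so the balls of radius `2 ^ (-k a)` at their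
corners have few points at scale `2 ^ (-k b)`. Strictness of `a / b < θ` leaves room for the factor
`d + 1` in `r` once `k` is large. -/
theorem IsMonotoneLowerExponent.le_thinnedLine {d : ℕ} {α : ℕ → ℕ → ℝ} {θ s : ℝ} {a b : ℕ}
    (ha : 0 < a) (hab : a < b) (hθ0 : 0 < θ) (hθ1 : θ < 1) (haθ : (a : ℝ) / b < θ) {u : ℝ}
    (hu0 : 0 ≤ u) (hu1 : u ≤ 1) (hu : ∀ k : ℕ, 0 < k → α (k * a) (k * b) = u)
    (hs : IsMonotoneLowerExponent (coordinateSet d (thinnedLine α)) θ s) : s ≤ d * u := by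
  obtain ⟨C, hC, H⟩ := isMonotoneLowerExponent_iff.1 hs
  have hb : 0 < b := ha.trans hab
  have hb' : (0 : ℝ) < b := by exact_mod_cast hb
  have hgap : 0 < θ * b - a := by
    rw [div_lt_iff₀ hb'] at haθ; linarith
  obtain ⟨k₀, hk₀⟩ := exists_nat_ge (Real.logb 2 (d + 1) / (θ * b - a) + Real.logb 2 (d + 1))
  have hd : (0 : ℝ) ≤ d := Nat.cast_nonneg d
  have hd1 : (0 : ℝ) < d + 1 := by positivity
  have hL : 0 ≤ Real.logb 2 (d + 1) := Real.logb_nonneg one_lt_two (by linarith)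
  set L := Real.logb 2 ((d : ℝ) + 1) with hLdef
  have hL2 : (d : ℝ) + 1 = 2 ^ L := by simp [hLdef, Real.rpow_logb two_pos (by norm_num) hd1]
  have half : ∀ j : ℕ, (1 / 2 : ℝ) ^ j = 2 ^ (-(j : ℝ)) := by
    intro j
    rw [Real.rpow_neg two_pos.le, Real.rpow_natCast, one_div, inv_pow]
  have hab' : (a : ℝ) + 1 ≤ b := by exact_mod_cast hab
  have hB : (1 : ℝ) < 2 ^ ((b : ℝ) - a) := Real.one_lt_rpow one_lt_two (by linarith)
  refine exponent_le_of_growth (c := C * 2 ^ (-(L * s))) (K := 2 ^ (d : ℝ)) (by positivity) hB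
    (k₀ + 1) fun k hk => ?_
  have hk0 : 0 < k := by omega
  have hk0' : (0 : ℝ) < k := by exact_mod_cast hk0
  have hk' : L / (θ * b - a) + L ≤ k := hk₀.trans (by exact_mod_cast (by omega : k₀ ≤ k))
  have hLgap : L ≤ k * (θ * b - a) := by
    rw [← div_le_iff₀ hgap]; linarith
  have hka : 0 < k * a := by positivity
  have hkab : k * a < k * b := Nat.mul_lt_mul_of_pos_left hab hk0
  set t : ℝ := 10 * (Nat.pair (k * a) (k * b) : ℝ) - 3 * (1 / 2) ^ (k * a) with ht
  have hmemS : ∀ y, y - t ∈ digitSet (thinnedSet (k * a) (k * b) u) → y ∈ thinnedLine α := by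
    intro y hy
    refine ⟨k * a, k * b, hka, hkab, Or.inr ?_⟩
    rw [hu k hk0]; exact hy
  have htS : t ∈ thinnedLine α := hmemS t (by rw [sub_self]; exact zero_mem_digitSet _)
  obtain ⟨Q, hQc, hQA, hQ⟩ := digitSet_cover
    (fun p => lt_of_mem_thinnedSet (α := u) hkab) (k * b)
  have hQS : ∀ y ∈ Q.map (addRightEmbedding t), y ∈ thinnedLine α := by
    intro y hy
    obtain ⟨y, hyQ, rfl⟩ := Finset.mem_map.1 hy
    exact hmemS _ (by simpa using hQA y hyQ)
  have hQcov : ∀ y ∈ thinnedLine α, |y - t| ≤ (1 / 2) ^ (k * a) →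
      ∃ z ∈ Q.map (addRightEmbedding t), |y - z| ≤ (1 / 2) ^ (k * b) := by
    intro y hy hyt
    have h2 := thinnedLine_near hka hkab hy hyt
    rw [hu k hk0] at h2
    obtain ⟨z, hz, hyz⟩ := hQ _ h2
    refine ⟨z + t, Finset.mem_map.2 ⟨z, hz, rfl⟩, ?_⟩
    convert hyz using 2; ring
  obtain ⟨D, hDc, hD⟩ := exists_cover_coordinateSet (d := d) (S := thinnedLine α)
    (x := ⟨WithLp.toLp 2 fun _ => t, fun _ => htS⟩) (R := (1 / 2) ^ (k * a))
    (δ := (1 / 2) ^ (k * b)) (by positivity) (fun _ => Q.map (addRightEmbedding t))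
    (fun _ => hQS) (fun _ => hQcov)
  have hrr : ((d : ℝ) + 1) * (1 / 2) ^ (k * b) = 2 ^ (L - k * b) := by
    rw [half, hL2, ← Real.rpow_add two_pos]; push_cast; rfl
  have hRR : (1 / 2 : ℝ) ^ (k * a) = 2 ^ (-(k * a : ℝ)) := by
    rw [half]; push_cast; rfl
  have hLk : L ≤ k * b := by
    have h2 : L ≤ k := by
      have : 0 ≤ L / (θ * b - a) := by positivity
      linarith
    nlinarith
  have hadm1 : ((d : ℝ) + 1) * (1 / 2) ^ (k * b) ≤ (((d : ℝ) + 1) * (1 / 2) ^ (k * b)) ^ θ := by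
    rw [hrr, ← Real.rpow_mul two_pos.le, Real.rpow_le_rpow_left_iff one_lt_two]
    nlinarith
  have hadm2 : (((d : ℝ) + 1) * (1 / 2) ^ (k * b)) ^ θ ≤ (1 / 2) ^ (k * a) := by
    rw [hrr, hRR, ← Real.rpow_mul two_pos.le, Real.rpow_le_rpow_left_iff one_lt_two]
    nlinarith
  have h3 := H (((d : ℝ) + 1) * (1 / 2) ^ (k * b)) ((1 / 2) ^ (k * a)) (by positivity)
    hadm1 hadm2 (pow_lt_one₀ (by norm_num) (by norm_num) hka.ne') _ D hD
  have h4 : (D.card : ℝ) ≤ 2 ^ (d * (u * (k * (b - a)) + 1)) := by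
    have h5 : D.card ≤ 2 ^ (d * digitCount (thinnedSet (k * a) (k * b) u) (k * a) (k * b)) := by
      refine hDc.trans ?_
      simp only [Finset.card_map, Finset.prod_const, Finset.card_univ, Fintype.card_fin]
      rw [mul_comm, pow_mul]
      exact Nat.pow_le_pow_left hQc d
    have h6 := digitCount_thinnedSet_le hkab hu0 hu1
    calc (D.card : ℝ) ≤ ((2 ^ (d * digitCount (thinnedSet (k * a) (k * b) u) (k * a) (k * b)) :
            ℕ) : ℝ) := by exact_mod_cast h5
      _ = 2 ^ ((d : ℝ) * digitCount (thinnedSet (k * a) (k * b) u) (k * a) (k * b)) := by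
          push_cast
          rw [← Real.rpow_natCast]; push_cast; rfl
      _ ≤ _ := by
          rw [Real.rpow_le_rpow_left_iff one_lt_two]
          push_cast at h6
          exact mul_le_mul_of_nonneg_left (by linarith) hd
  have h5 := h3.trans h4
  rw [hrr, hRR, ← Real.rpow_sub two_pos, ← Real.rpow_mul two_pos.le] at h5
  rw [← Real.rpow_natCast, ← Real.rpow_mul two_pos.le, ← Real.rpow_mul two_pos.le,
    ← Real.rpow_mul two_pos.le, mul_assoc, ← Real.rpow_add two_pos, ← Real.rpow_add two_pos]
  rwa [show -(L * s) + ((b : ℝ) - a) * k * s = (-(k * a) - (L - k * b)) * s by ring,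
    show (d : ℝ) + ((b : ℝ) - a) * k * (d * u) = d * (u * (k * (b - a)) + 1) by ring]

/-! ### Realisation of `φ` and conclusion -/

theorem exists_set_of_conditions {d : ℕ} {φ : ℝ → ℝ}
    (hφ : ∀ θ ∈ Set.Ioc (0 : ℝ) 1, φ θ ∈ Set.Icc (0 : ℝ) d)
    (hanti : AntitoneOn (fun θ => φ θ / (1 - θ)) (Set.Ioo 0 1)) (hone : φ 1 = 0)
    (hmul : ∀ l ∈ Set.Ioc (0 : ℝ) 1, ∀ θ ∈ Set.Ioc (0 : ℝ) 1,
      φ (l * θ) - θ * φ l ≤ (1 - θ) * d) :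
    ∃ F : Set (EuclideanSpace ℝ (Fin d)), F.Nonempty ∧
      ∀ θ ∈ Set.Ioc (0 : ℝ) 1, scaledMonotoneLowerSpectrum F θ = ENNReal.ofReal (φ θ) := by
  have hd : (0 : ℝ) ≤ d := Nat.cast_nonneg d
  set β : ℝ → ℝ := fun θ => if θ ∈ Set.Ioo (0 : ℝ) 1 then φ θ / (1 - θ) / d else 0 with hβ
  have hβφ : ∀ θ ∈ Set.Ioo (0 : ℝ) 1, d * β θ = φ θ / (1 - θ) := by
    intro θ hθ
    simp only [hβ, if_pos hθ]
    -- For `d = 0` the division by `d` makes `β` zero, which is consistent because `φ` vanishes.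
    rcases Nat.eq_zero_or_pos d with rfl | hpos
    · have h2 := hφ θ ⟨hθ.1, hθ.2.le⟩
      have h3 : φ θ = 0 := le_antisymm (by simpa using h2.2) h2.1
      simp [h3]
    · have : (d : ℝ) ≠ 0 := by exact_mod_cast hpos.ne'
      field_simp
  have hβ0 : ∀ θ, 0 ≤ β θ := by
    intro θ
    simp only [hβ]
    split_ifs with h
    · have := (hφ θ ⟨h.1, h.2.le⟩).1
      have : 0 < 1 - θ := by linarith [h.2]
      positivity
    · exact le_rfl
  have hβ1 : ∀ θ, β θ ≤ 1 := by
    intro θ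
    simp only [hβ]
    split_ifs with h
    · have h2 := hmul 1 (by simp) θ ⟨h.1, h.2.le⟩
      rw [one_mul, hone] at h2
      have : 0 < 1 - θ := by linarith [h.2]
      refine div_le_one_of_le₀ ?_ hd
      rw [div_le_iff₀ this]; linarith
    · exact zero_le_one
  have hβanti : ∀ q ∈ Set.Ioo (0 : ℝ) 1, ∀ θ ∈ Set.Ioo (0 : ℝ) 1, q ≤ θ → β θ ≤ β q := by
    intro q hq θ hθ hqθ
    simp only [hβ, if_pos hq, if_pos hθ]
    have : φ θ / (1 - θ) ≤ φ q / (1 - q) := hanti hq hθ hqθ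
    gcongr
  have hβmul : ∀ q ∈ Set.Ioo (0 : ℝ) 1, ∀ θ ∈ Set.Ioo (0 : ℝ) 1, θ ≤ q →
      (1 - θ) * β θ ≤ 1 - θ / q * (1 - (1 - q) * β q) := by
    intro q hq θ hθ hθq
    have hx1 : θ / q ≤ 1 := (div_le_one hq.1).2 hθq
    have hx0 : 0 < θ / q := div_pos hθ.1 hq.1
    have hp : 0 < 1 - q := by linarith [hq.2]
    have hp' : 0 < 1 - θ := by linarith [hθ.2]
    rcases Nat.eq_zero_or_pos d with rfl | hpos
    · have e : ∀ x, β x = 0 := fun x => by simp [hβ]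
      rw [e, e]; simpa using hx1
    · have hpos' : (0 : ℝ) < d := by exact_mod_cast hpos
      have h2 := hmul q ⟨hq.1, hq.2.le⟩ (θ / q) ⟨hx0, hx1⟩
      rw [mul_div_cancel₀ _ hq.1.ne'] at h2
      have e1 : φ θ = d * ((1 - θ) * β θ) := by
        rw [mul_left_comm, hβφ θ hθ]; field_simp
      have e2 : φ q = d * ((1 - q) * β q) := by
        rw [mul_left_comm, hβφ q hq]; field_simp
      rw [e1, e2] at h2
      refine le_of_mul_le_mul_left ?_ hpos'
      linarith
  have frac : ∀ a b : ℕ, 0 < a → a < b → (a : ℝ) / b ∈ Set.Ioo (0 : ℝ) 1 := by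
    intro a b ha hab
    have ha' : (0 : ℝ) < a := by exact_mod_cast ha
    have hb' : (0 : ℝ) < b := by exact_mod_cast ha.trans hab
    exact ⟨by positivity, (div_lt_one hb').2 (by exact_mod_cast hab)⟩
  set α : ℕ → ℕ → ℝ := fun a b => β ((a : ℝ) / b) with hα
  refine ⟨coordinateSet d (thinnedLine α), ?_, fun θ hθ => ?_⟩
  · refine ⟨WithLp.toLp 2 fun _ => 10 * (Nat.pair 1 2 : ℝ), fun i => ⟨1, 2, one_pos, one_lt_two,
      Or.inl ?_⟩⟩
    simpa using zero_mem_digitSet _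
  rcases eq_or_lt_of_le hθ.2 with rfl | hθ1
  · simp [scaledMonotoneLowerSpectrum, hone]
  have hθ' : θ ∈ Set.Ioo (0 : ℝ) 1 := ⟨hθ.1, hθ1⟩
  have hp : 0 < 1 - θ := by linarith
  refine scaledMonotoneLowerSpectrum_eq hθ1 (hφ θ hθ).1 ?_ fun s _ hs => ?_
  · rw [← hβφ θ hθ']
    exact isMonotoneLowerExponent_thinnedLine d (fun _ _ => hβ0 _) (fun _ _ => hβ1 _) hθ.1 hθ1
      (hβ0 θ) (hβ1 θ) (fun a b ha hab h => hβanti _ (frac a b ha hab) θ hθ' h)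
      (fun a b ha hab h => hβmul _ (frac a b ha hab) θ hθ' h)
  · have upper : ∀ q : ℚ, 0 < (q : ℝ) → (q : ℝ) < θ →
        (1 - q) * s ≤ (1 - q / θ) * d + q / θ * φ θ := by
      intro q hq0 hqθ
      have hq1 : (q : ℝ) < 1 := hqθ.trans hθ1
      have hnum : 0 < q.num := Rat.num_pos.2 (by exact_mod_cast hq0)
      obtain ⟨a, ha⟩ := Int.eq_ofNat_of_zero_le hnum.le
      have hqab : (q : ℝ) = (a : ℝ) / q.den := by
        rw [Rat.cast_def, ha]; simp
      have hb : (0 : ℝ) < q.den := by exact_mod_cast q.den_pos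
      have ha0 : 0 < a := by omega
      have hab : a < q.den := by
        rw [hqab, div_lt_one hb] at hq1
        exact_mod_cast hq1
      have h2 : s ≤ d * β q := by
        refine hs.le_thinnedLine ha0 hab hθ.1 hθ1 (by rwa [← hqab]) (hβ0 _) (hβ1 _)
          fun k hk => ?_
        have hk' : (k : ℝ) ≠ 0 := by exact_mod_cast hk.ne'
        simp only [hα, hqab]
        push_cast
        rw [mul_div_mul_left _ _ hk']
      rw [hβφ q ⟨hq0, hq1⟩, le_div_iff₀ (by linarith)] at h2
      have h3 := hmul θ hθ (q / θ) ⟨div_pos hq0 hθ.1, (div_le_one hθ.1).2 hqθ.le⟩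
      rw [mul_div_cancel₀ _ hθ.1.ne'] at h3
      linarith
    by_contra! hlt
    have hcont : Continuous fun q : ℝ => (1 - q) * s - ((1 - q / θ) * d + q / θ * φ θ) := by
      fun_prop
    have hpos : ∀ᶠ q in nhdsWithin θ (Set.Iio θ),
        0 < (1 - q) * s - ((1 - q / θ) * d + q / θ * φ θ) := by
      refine (hcont.tendsto θ).mono_left nhdsWithin_le_nhds |>.eventually_const_lt ?_
      rw [div_self hθ.1.ne']
      linarith
    obtain ⟨l, hl, hlθ⟩ := (mem_nhdsLT_iff_exists_Ioo_subset).1 hpos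
    obtain ⟨q, hq1, hq2⟩ := exists_rat_btwn (max_lt hl hθ.1 : max l 0 < θ)
    have h2 := upper q ((le_max_right _ _).trans_lt hq1) hq2
    have h3 : 0 < (1 - (q : ℝ)) * s - ((1 - q / θ) * d + q / θ * φ θ) :=
      hlθ ⟨(le_max_left _ _).trans_lt hq1, hq2⟩
    linarith

theorem corollaryD (d : ℕ) (φ : ℝ → ℝ)
    (hφ : ∀ θ ∈ Set.Ioc (0 : ℝ) 1, φ θ ∈ Set.Icc (0 : ℝ) d) :
    ((∃ F : Set (EuclideanSpace ℝ (Fin d)), F.Nonempty ∧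
        ∀ θ ∈ Set.Ioc (0 : ℝ) 1, scaledMonotoneLowerSpectrum F θ = ENNReal.ofReal (φ θ)) ↔
      (AntitoneOn (fun θ => φ θ / (1 - θ)) (Set.Ioo 0 1) ∧ φ 1 = 0 ∧
        ∀ l ∈ Set.Ioc (0 : ℝ) 1, ∀ θ ∈ Set.Ioc (0 : ℝ) 1,
          φ (l * θ) - θ * φ l ≤ (1 - θ) * d)) ∧
    ((∃ F : Set (EuclideanSpace ℝ (Fin d)), F.Nonempty ∧
        ∀ θ ∈ Set.Ioc (0 : ℝ) 1, scaledMonotoneLowerSpectrum F θ = ENNReal.ofReal (φ θ)) ↔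
      (∃ S : Set (ℝ × ℝ), S.Nonempty ∧
        (∀ p ∈ S, p.1 ∈ Set.Ioc (0 : ℝ) 1 ∧ p.2 ∈ Set.Icc (0 : ℝ) (d * (1 - p.1))) ∧
        ∀ θ ∈ Set.Ioc (0 : ℝ) 1,
          IsGLB ((fun p : ℝ × ℝ => twoPieceAffine d p.1 p.2 θ) '' S) (φ θ))) := by
  have h23 := conditions_iff_isGLB_twoPieceAffine d φ hφ
  have h12 : (∃ F : Set (EuclideanSpace ℝ (Fin d)), F.Nonempty ∧
      ∀ θ ∈ Set.Ioc (0 : ℝ) 1, scaledMonotoneLowerSpectrum F θ = ENNReal.ofReal (φ θ)) ↔ _ :=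
    ⟨fun ⟨_, hF, h⟩ => scaled_spectrum_conditions hφ hF h,
      fun ⟨h1, h2, h3⟩ => exists_set_of_conditions hφ h1 h2 h3⟩
  exact ⟨h12, h12.trans h23⟩
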